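/- **Conventions.** A graph has a finite non-empty vertex set and a finite edge set; loops and multiple edges are allowed. A weighted graph is a graph with an edge length $m(e)>0$ for every edge $e$; it gives rise to a metric graph, by gluing intervals $[0,m(e)]$ along the vertices. A polarization of a graph with vertex set $V$ is a function $\mathbf q\colon V\to\mathbb Z_{\ge 0}$ such that the canonical divisor $K(p)=v(p)-2+2\mathbf q(p)$ satisfies $K(p)\ge 0$ for all $p\in V$, where $v(p)$ is the valency (loops count twice). A polarized metric graph $\overline\Gamma=(\Gamma,\mathbf q)$ is the metric graph $\Gamma$ of a polarized weighted graph, with $\mathbf q$ and $K$ extended by zero to $\Gamma$; any polarized weighted graph giving rise to $\overline\Gamma$ is called a model of it. If $\Gamma$ is connected, the genus of $\overline\Gamma$ is $g=b_1(\Gamma)+\sum_p\mathbf q(p)=\frac12(\deg K+2)$. When $g\ge 2$, the minimal model of $\overline\Gamma$ is the model whose vertex set is the support of $K$. A bridge is an edge whose removal increases the number of connected components. A weighted graph is 2-connected if its metric graph is connected and cannot be disconnected by deleting a single point. For $y,z\in\Gamma$ let $j_z(\cdot,y)$ be the unique continuous piecewise affine function on $\Gamma$ with $\Delta j_z(\cdot,y)=\delta_y-\delta_z$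 and $j_z(z,y)=0$, where $\Delta f=-\sum_p s_p(f)\,\delta_p$ and $s_p(f)$ is the sum of the outgoing slopes of $f$ at $p$. For a probability measure $\mu$ on $\Gamma$ let $$g_\mu(x,y)=\int j_\zeta(x,y)\,d\mu(\zeta)-\iint j_\zeta(\xi,y)\,d\mu(\zeta)\,d\mu(\xi)$$ be its Green's function (so $\Delta_x g_\mu(x,y)=\delta_y-\mu$ and $\int g_\mu(x,y)\,d\mu(x)=0$). The admissible measure $\mu$ of $\overline\Gamma$ is the unique probability measure such that $g_\mu(x,x)+\sum_p K(p)\,g_\mu(p,x)$ does not depend on $x$. With this $\mu$, and with $\delta$ the total length of $\Gamma$, put $$\varphi=-\tfrac14\delta+\tfrac14\int_\Gamma g_\mu(x,x)\bigl((10g+2)\mu(x)-\delta_K(x)\bigr),\qquad \epsilon=\int_\Gamma g_\mu(x,x)\bigl((2g-2)\mu(x)+\delta_K(x)\bigr),$$ $$\lambda=\frac{g-1}{6(2g+1)}\varphi+\frac1{12}(\delta+\epsilon).$$ The slope of $\overline\Gamma$ is $$s(\overline\Gamma)=(8g+4)\lambda-g\,\delta_0-\sum_{h=1}^{\lfloor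 g/2\rfloor}4h(g-h)\,\delta_h,$$ where $\delta_0$ is the total length of the edges that are not bridges and $\delta_h$ is the total length of the bridges whose removal leaves a component of genus $h$ and a component of genus $g-h$. **Theorem.** Let $\overline\Gamma=(\Gamma,\mathbf q)$ be a bridgeless connected polarized metric graph of genus at least two, and let $\overline G=(G,\mathbf q)$ be its minimal model, with vertex set $V$. (a) If $|V|=1$, then $s(\overline\Gamma)=0$. (b) If $|V|\ge 2$ and $\mathbf q\not\equiv 0$, then $s(\overline\Gamma)>0$. (c) If $G$ is 2-connected and $|V|\ge 3$, then $s(\overline\Gamma)>0$. -/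

import Mathlib

open MeasureTheory

/-- A (finite) weighted graph with vertex set `V` and edge set `E`; loops and multiple edges are
allowed.  Each edge `e` carries an (auxiliary, arbitrary) orientation from `tail e` to `head e`,
used only to parametrize it by `[0, len e]`. -/
structure WeightedGraph (V E : Type*) where
  tail : E → V
  head : E → V
  len : E → ℝ
  len_pos : ∀ e, 0 < len e

namespace WeightedGraph

variable {V E : Type*}

/-- The simple graph on `V` recording which vertices are joined by an edge of `G` outside `S`. -/
def adjDelete (G : WeightedGraph V E) (S : Set E) : SimpleGraph V :=
  SimpleGraph.fromRel fun u v => ∃ e, e ∉ S ∧ G.tail e = u ∧ G.head e = v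

/-- The graph is (non-empty and) connected. -/
def Connected (G : WeightedGraph V E) : Prop := (G.adjDelete ∅).Connected

/-- A bridge: an edge whose endpoints lie in different components once it is removed. -/
def IsBridge (G : WeightedGraph V E) (e : E) : Prop :=
  ¬ (G.adjDelete {e}).Reachable (G.tail e) (G.head e)

/-- No edge is a bridge. -/
def Bridgeless (G : WeightedGraph V E) : Prop := ∀ e, ¬ G.IsBridge e

open Classical in
/-- The number of half-edges emanating from a vertex (a loop counts twice). -/
noncomputable def valency [Fintype E] (G : WeightedGraph V E) (v : V) : ℕ :=
  (Finset.univ.filter fun e => G.tail e = v).card + (Finset.univ.filter fun e => G.head e = v).card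

/-- The points of the metric graph `Γ` of the weighted graph `G`: the vertices, and for each edge
`e` an open interval of length `len e`. -/
inductive Point (G : WeightedGraph V E) where
  | vertex (v : V) : Point G
  | inner (e : E) (t : ℝ) (ht : t ∈ Set.Ioo 0 (G.len e)) : Point G

open Classical in
/-- The parametrization `[0, len e] → Γ` of the closed edge `e`, running from `tail e` to `head e`
(extended to `ℝ` by constants). -/
noncomputable def param (G : WeightedGraph V E) (e : E) (t : ℝ) : G.Point :=
  if h : t ∈ Set.Ioo 0 (G.len e) then Point.inner e t h
  else if t ≤ 0 then Point.vertex (G.tail e) else Point.vertex (G.head e)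

/-- The topology of the metric graph: a set is open iff its preimage in every edge is open.  This
is the quotient topology of the disjoint union of the vertices and the closed edges. -/
noncomputable instance (G : WeightedGraph V E) : TopologicalSpace G.Point :=
  ⨆ e, TopologicalSpace.coinduced (G.param e) inferInstance

noncomputable instance (G : WeightedGraph V E) : MeasurableSpace G.Point := borel G.Point

instance (G : WeightedGraph V E) : BorelSpace G.Point := ⟨rfl⟩

/-- The length measure `dx` on the metric graph. -/
noncomputable def lengthMeasure [Fintype E] (G : WeightedGraph V E) : Measure G.Point :=
  ∑ e, (volume.restrict (Set.Icc 0 (G.len e))).map (G.param e)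

/-- The metric graph of `G` is topologically `2`-connected: it is connected, and it cannot be
disconnected by deleting a single point. -/
def TwoConnected (G : WeightedGraph V E) : Prop :=
  ConnectedSpace G.Point ∧ ∀ x : G.Point, IsPreconnected ({x}ᶜ : Set G.Point)

/-- `f` is piecewise affine: each edge has finitely many break points such that `f` is affine on
every closed subinterval without break points in its interior. -/
def PiecewiseAffine (G : WeightedGraph V E) (f : G.Point → ℝ) : Prop :=
  ∀ e, ∃ S : Finset ℝ, ∀ a b : ℝ, 0 ≤ a → a < b → b ≤ G.len e → (∀ s ∈ S, s ∉ Set.Ioo a b) →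
    ∃ c d : ℝ, ∀ t ∈ Set.Icc a b, f (G.param e t) = c * t + d

open Classical in
/-- The sum of the slopes of `f` at a point, over all outgoing tangent directions. -/
noncomputable def outSlopeSum [Fintype E] (G : WeightedGraph V E) (f : G.Point → ℝ) :
    G.Point → ℝ
  | .vertex v =>
      (∑ e, if G.tail e = v then derivWithin (fun t => f (G.param e t)) (Set.Ici 0) 0 else 0) +
      ∑ e, if G.head e = v then
        -derivWithin (fun t => f (G.param e t)) (Set.Iic (G.len e)) (G.len e) else 0
  | .inner e t _ =>
      derivWithin (fun s => f (G.param e s)) (Set.Ici t) t -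
        derivWithin (fun s => f (G.param e s)) (Set.Iic t) t

open Classical in
/-- `f` is continuous and piecewise affine, `f z = 0`, and `Δ f = δ_y - δ_z`, where
`Δ f = - ∑_p (outSlopeSum f p) δ_p` is the distributional Laplacian of such a function. -/
def IsJFunction [Fintype E] (G : WeightedGraph V E) (z y : G.Point) (f : G.Point → ℝ) : Prop :=
  Continuous f ∧ G.PiecewiseAffine f ∧
    (∀ p, -G.outSlopeSum f p = (if p = y then 1 else 0) - (if p = z then 1 else 0)) ∧ f z = 0

/-- The `j`-function: `x ↦ j z x y` is the unique function with the property `IsJFunction z y`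
(it exists and is unique when the graph is connected). -/
noncomputable def j [Fintype E] (G : WeightedGraph V E) (z x y : G.Point) : ℝ :=
  Classical.epsilon (G.IsJFunction z y) x

/-- The Green's function `g_μ(x,y)` of a measure `μ` of total mass one, that is, the function with
`Δ_x g_μ(x,y) = δ_y - μ` and `∫ g_μ(x,y) dμ(x) = 0`: since `Δ_x j_ζ(x,y) = δ_y - δ_ζ`, it is the
`μ`-average of `j_ζ(x,y)` over `ζ`, normalized to have integral zero in `x`. -/
noncomputable def green [Fintype E] (G : WeightedGraph V E) (μ : Measure G.Point)
    (x y : G.Point) : ℝ :=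
  (∫ ζ, G.j ζ x y ∂μ) - ∫ ξ, (∫ ζ, G.j ζ ξ y ∂μ) ∂μ

end WeightedGraph

/-- A polarized weighted graph.  It gives rise to the polarized metric graph with underlying space
`Point`, designated vertex set `V` and polarization `q`. -/
structure PolarizedGraph (V E : Type*) [Fintype E] extends WeightedGraph V E where
  q : V → ℕ
  polarized : ∀ v, 2 ≤ toWeightedGraph.valency v + 2 * q v

namespace PolarizedGraph

variable {V E : Type*} [Fintype V] [Fintype E]

/-- The coefficient of the canonical divisor at a vertex. -/
noncomputable def K (G : PolarizedGraph V E) (v : V) : ℤ := G.valency v - 2 + 2 * G.q v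

/-- The polarization as a function on the metric graph, zero outside the vertices. -/
def qPoint (G : PolarizedGraph V E) : G.Point → ℕ
  | .vertex v => G.q v
  | .inner _ _ _ => 0

/-- The canonical divisor of the metric graph: interior points of edges have coefficient
`2 - 2 + 0 = 0`. -/
noncomputable def KPoint (G : PolarizedGraph V E) : G.Point → ℤ
  | .vertex v => G.K v
  | .inner _ _ _ => 0

/-- The genus of a connected polarized graph: the first Betti number `|E| - |V| + 1` plus the sum of
the genera of the vertices. -/
def genus (G : PolarizedGraph V E) : ℤ :=
  (Fintype.card E : ℤ) - Fintype.card V + 1 + ∑ v, (G.q v : ℤ)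

/-- `μ` is an admissible measure: a measure of total mass one such that
`g_μ(x,x) + g_μ(K,x)` does not depend on the point `x`. -/
def IsAdmissible (G : PolarizedGraph V E) (μ : Measure G.Point) : Prop :=
  IsProbabilityMeasure μ ∧
    ∃ c : ℝ, ∀ x, G.green μ x x + ∑ v, (G.K v : ℝ) * G.green μ (.vertex v) x = c

/-- The admissible measure (unique for connected graphs of positive genus). -/
noncomputable def admissibleMeasure (G : PolarizedGraph V E) : Measure G.Point :=
  Classical.epsilon G.IsAdmissible

/-- The values `g_μ(x,x)` of the admissible Green's function on the diagonal. -/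
noncomputable def greenDiag (G : PolarizedGraph V E) (x : G.Point) : ℝ :=
  G.green G.admissibleMeasure x x

/-- The total length. -/
def totalLength (G : PolarizedGraph V E) : ℝ := ∑ e, G.len e

/-- Zhang's invariant `φ`. -/
noncomputable def phi (G : PolarizedGraph V E) : ℝ :=
  -(1 / 4) * G.totalLength + (1 / 4) *
    ((10 * G.genus + 2) * (∫ x, G.greenDiag x ∂G.admissibleMeasure) -
      ∑ v, (G.K v : ℝ) * G.greenDiag (.vertex v))

/-- Zhang's invariant `ε`. -/
noncomputable def epsilon (G : PolarizedGraph V E) : ℝ :=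
  (2 * G.genus - 2) * (∫ x, G.greenDiag x ∂G.admissibleMeasure) +
    ∑ v, (G.K v : ℝ) * G.greenDiag (.vertex v)

/-- Zhang's invariant `λ`. -/
noncomputable def lam (G : PolarizedGraph V E) : ℝ :=
  (G.genus - 1) / (6 * (2 * G.genus + 1)) * G.phi + (1 / 12) * (G.totalLength + G.epsilon)

open Classical in
/-- The genus of the component containing the vertex `v` of the graph obtained from `G` by removing
the edge `e`. -/
noncomputable def componentGenus (G : PolarizedGraph V E) (e : E) (v : V) : ℤ :=
  let C : Finset V := Finset.univ.filter fun u => (G.adjDelete {e}).Reachable v u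
  ((Finset.univ.filter fun e' => e' ≠ e ∧ G.tail e' ∈ C).card : ℤ) - C.card + 1 +
    ∑ u ∈ C, (G.q u : ℤ)

/-- A bridge of type `h`: its removal leaves a component of genus `h` and one of genus `g - h`. -/
def IsBridgeOfType (G : PolarizedGraph V E) (h : ℤ) (e : E) : Prop :=
  G.IsBridge e ∧
    ((G.componentGenus e (G.tail e) = h ∧ G.componentGenus e (G.head e) = G.genus - h) ∨
     (G.componentGenus e (G.head e) = h ∧ G.componentGenus e (G.tail e) = G.genus - h))

open Classical in
/-- `δ_0`: the total length of the edges that are not bridges. -/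
noncomputable def delta0 (G : PolarizedGraph V E) : ℝ :=
  ∑ e, if G.IsBridge e then 0 else G.len e

open Classical in
/-- `δ_h`: the total length of the bridges of type `h`. -/
noncomputable def delta (G : PolarizedGraph V E) (h : ℤ) : ℝ :=
  ∑ e, if G.IsBridgeOfType h e then G.len e else 0

/-- The slope of the polarized metric graph of `G`. -/
noncomputable def slope (G : PolarizedGraph V E) : ℝ :=
  (8 * G.genus + 4) * G.lam - G.genus * G.delta0 -
    ∑ h ∈ Finset.Icc (1 : ℤ) (G.genus / 2), 4 * (h : ℝ) * (G.genus - h) * G.delta h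

/-- `G` is the minimal model of the polarized metric graph `Γ` of `H`: the metric graph of `G` is
isometric to `Γ`, compatibly with the polarizations, in such a way that the vertex set of `G`
becomes the support of the canonical divisor of `Γ`.  (A homeomorphism of metric graphs is an
isometry iff it preserves the length measure.) -/
def IsMinimalModel {V' E' : Type*} [Fintype V'] [Fintype E'] (G : PolarizedGraph V' E')
    (H : PolarizedGraph V E) : Prop :=
  ∃ Φ : G.Point ≃ₜ H.Point,
    G.lengthMeasure.map Φ = H.lengthMeasure ∧
    (∀ x, H.qPoint (Φ x) = G.qPoint x) ∧
    Φ '' Set.range WeightedGraph.Point.vertex = Function.support H.KPoint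

end PolarizedGraph

/-!
Write `F e = L / (L + R)` for the Foster coefficient of an edge `e` of length `L`, where `R` is the
resistance between its endpoints after the removal of `e`, and `r(x, y)` for the effective
resistance.  The theorem follows from a formula for the slope of a bridgeless polarized graph as a
sum of nonnegative local terms (`PolarizedGraph.slope_eq_sum`):

`s = ∑ y, K(y) * (∑ p, q(p) * r(p, y) + ∑ e, F(e) * Y(e, y))`.

Here `Y(e, y)` is the resistance in `Γ - e` between `y` and the centre of the star that is
equivalent to `Γ - e` with the terminals `y` and the two endpoints of `e`.  The term
`F(e) * Y(e, y)`, called the excess below, compares the conductance of `e` with the conductance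
between its endpoints in the triangle equivalent to `Γ` with terminals `y` and these endpoints; the
latter is at least as large.  Thus the excess is nonnegative, and if `y` is not an endpoint of `e`,
it is zero exactly when `y` separates the endpoints of `e` in `Γ - e`
(`IsGreenKernel.excess_nonneg`, `excess_pos`, `excess_eq_zero`).

* If `K` is supported at a single vertex `y`, all other vertices have valency two and `q = 0`, so
  `y` separates the endpoints of every edge not containing it, and all terms vanish.
* If `q(p) ≠ 0` and `y ≠ p` is in the support of `K`, the term `K(y) * q(p) * r(p, y)` is positive.
* If `q = 0` and the slope is not positive, then `Γ - y` is a forest for all `y` in the support of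
  `K`.  Counting edges gives `K(y) ≥ g - 1` for such `y`; as `K` has degree `2 g - 2`, its support
  has at most two points.

To derive the formula, fix a root `o` and let `M` be the Green kernel of the network on the
vertices, grounded at `o`.  It extends to an explicit kernel `k` on the metric graph by bilinear
interpolation and the Dirichlet Green functions of the edges, and
`j_z(x, y) = k(x, y) - k(x, z) - k(z, y) + k(z, z)` (`WeightedGraph.j_eq_kernel`).  A probability
measure `μ` is admissible if and only if `2 g k(μ, x) = k(x, x) + k(K, x)` for all `x`, and the
measure `(1 / g) (∑ v, q v δ_v + ∑ e, (F e / len e) dx)` has this property.  So the potential of an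
admissible measure is explicit, and by Fubini's theorem its energy is the same for all admissible
measures.  Everything then reduces to identities for `M`, based on the fact that the Laplacian of
its diagonal is `2 w - 2 δ_o`, with `w` the discrete canonical measure
(`IsGreenKernel.energy_diag`).
-/

/-! ### The Dirichlet form and the grounded Green kernel -/

namespace WeightedGraph

variable {V E : Type*}

/-- The Dirichlet form of the electrical network in which the edge `e` has resistance `len e`. -/
noncomputable def energy [Fintype E] (G : WeightedGraph V E) (f h : V → ℝ) : ℝ :=
  ∑ e, (f (G.tail e) - f (G.head e)) * (h (G.tail e) - h (G.head e)) / G.len e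

theorem eq_of_reachable {α : Type*} {A : SimpleGraph V} {f : V → α}
    (h : ∀ u v, A.Adj u v → f u = f v) {u v : V} (huv : A.Reachable u v) : f u = f v := by
  obtain ⟨p⟩ := huv
  induction p with
  | nil => rfl
  | cons hadj _ ih => exact (h _ _ hadj).trans ih

theorem adjDelete_adj {G : WeightedGraph V E} {S : Set E} {u v : V} :
    (G.adjDelete S).Adj u v ↔ u ≠ v ∧ ∃ e, e ∉ S ∧
      ((G.tail e = u ∧ G.head e = v) ∨ (G.tail e = v ∧ G.head e = u)) := by
  simp only [adjDelete, SimpleGraph.fromRel_adj]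
  refine and_congr_right fun _ => ⟨?_, ?_⟩
  · rintro (⟨e, he, h⟩ | ⟨e, he, h⟩)
    · exact ⟨e, he, Or.inl h⟩
    · exact ⟨e, he, Or.inr h⟩
  · rintro ⟨e, he, h | h⟩
    · exact Or.inl ⟨e, he, h⟩
    · exact Or.inr ⟨e, he, h⟩

theorem reachable_tail_head (G : WeightedGraph V E) {S : Set E} {e : E} (he : e ∉ S) :
    (G.adjDelete S).Reachable (G.tail e) (G.head e) := by
  by_cases h : G.tail e = G.head e
  · rw [h]
  · exact SimpleGraph.Adj.reachable (adjDelete_adj.2 ⟨h, e, he, Or.inl ⟨rfl, rfl⟩⟩)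

/-- A function that agrees at both ends of every edge outside `S` is constant on the components of
the graph without the edges of `S`. -/
theorem eq_of_reachable_adjDelete {α : Type*} {G : WeightedGraph V E} {S : Set E} {f : V → α}
    (h : ∀ e, e ∉ S → f (G.tail e) = f (G.head e)) {u v : V}
    (huv : (G.adjDelete S).Reachable u v) : f u = f v := by
  refine eq_of_reachable (fun u v huv => ?_) huv
  obtain ⟨-, e, he, ⟨rfl, rfl⟩ | ⟨rfl, rfl⟩⟩ := adjDelete_adj.1 huv
  · exact h e he
  · exact (h e he).symm

theorem energy_term_nonneg {G : WeightedGraph V E} (f : V → ℝ) (e : E) :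
    0 ≤ (f (G.tail e) - f (G.head e)) * (f (G.tail e) - f (G.head e)) / G.len e :=
  div_nonneg (mul_self_nonneg _) (G.len_pos e).le

section Energy

variable [Fintype E] {G : WeightedGraph V E}

theorem energy_comm (f h : V → ℝ) : G.energy f h = G.energy h f := by
  simp only [energy, mul_comm]

theorem energy_add_right (f h₁ h₂ : V → ℝ) :
    G.energy f (fun x => h₁ x + h₂ x) = G.energy f h₁ + G.energy f h₂ := by
  simp only [energy, ← Finset.sum_add_distrib]
  exact Finset.sum_congr rfl fun e _ => by ring

theorem energy_smul_right (c : ℝ) (f h : V → ℝ) :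
    G.energy f (fun x => c * h x) = c * G.energy f h := by
  simp only [energy, Finset.mul_sum]
  exact Finset.sum_congr rfl fun e _ => by ring

theorem energy_const_right (c : ℝ) (f : V → ℝ) : G.energy f (fun _ => c) = 0 := by
  simp [energy]

theorem energy_sub_right (f h₁ h₂ : V → ℝ) :
    G.energy f (fun x => h₁ x - h₂ x) = G.energy f h₁ - G.energy f h₂ := by
  simp only [energy, ← Finset.sum_sub_distrib]
  exact Finset.sum_congr rfl fun e _ => by ring

theorem energy_self_nonneg (f : V → ℝ) : 0 ≤ G.energy f f :=
  Finset.sum_nonneg fun e _ => energy_term_nonneg f e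

theorem eq_of_energy_self_eq_zero (hG : G.Connected) {f : V → ℝ} (hf : G.energy f f = 0)
    (u v : V) : f u = f v := by
  have h := (Finset.sum_eq_zero_iff_of_nonneg fun e _ => energy_term_nonneg f e).1 hf
  refine eq_of_reachable_adjDelete (S := ∅) (fun e _ => ?_) (hG.preconnected u v)
  have := h e (Finset.mem_univ e)
  rw [div_eq_zero_iff, or_iff_left (G.len_pos e).ne', mul_self_eq_zero, sub_eq_zero] at this
  exact this

end Energy

/-- `M` is the Green kernel of the network grounded at the vertex `o`: `M x y` is the potential at
`x` when a unit current enters at `y` and leaves at `o`, and the potential at `o` is zero.  The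
equation `Δ M(·, y) = δ_y - δ_o` is stated weakly, as a reproducing property for the Dirichlet
form. -/
structure IsGreenKernel [Fintype E] (G : WeightedGraph V E) (o : V) (M : V → V → ℝ) : Prop where
  zero_left : ∀ y, M o y = 0
  energy_eq : ∀ (f : V → ℝ) (y : V), G.energy f (fun x => M x y) = f y - f o

theorem exists_isGreenKernel [Fintype V] [Fintype E] {G : WeightedGraph V E} (hG : G.Connected)
    (o : V) : ∃ M, G.IsGreenKernel o M := by
  classical
  -- Adding a unit conductance at `o` makes the Dirichlet form positive definite.
  let B : LinearMap.BilinForm ℝ (V → ℝ) := LinearMap.mk₂ ℝ (fun f h => G.energy f h + f o * h o)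
    (fun f₁ f₂ h => by
      rw [energy_comm, energy_comm f₁, energy_comm f₂]
      have := energy_add_right (G := G) h f₁ f₂
      simp only [Pi.add_apply]
      rw [← sub_eq_zero] at this ⊢
      rw [← this]
      simp only [energy, Pi.add_apply]
      ring)
    (fun c f h => by
      have := energy_smul_right (G := G) c h f
      rw [energy_comm, energy_comm f]
      change G.energy h (fun x => c * f x) + c * f o * h o = c * _
      rw [this]; ring)
    (fun f h₁ h₂ => by
      have := energy_add_right (G := G) f h₁ h₂
      change G.energy f (fun x => h₁ x + h₂ x) + f o * (h₁ o + h₂ o) = _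
      rw [this]; ring)
    (fun c f h => by
      have := energy_smul_right (G := G) c f h
      change G.energy f (fun x => c * h x) + f o * (c * h o) = c * _
      rw [this]; ring)
  have hB : ∀ f h, B f h = G.energy f h + f o * h o := fun f h => rfl
  have hinj : Function.Injective (B.flip : (V → ℝ) →ₗ[ℝ] Module.Dual ℝ (V → ℝ)) := by
    rw [← LinearMap.ker_eq_bot, LinearMap.ker_eq_bot']
    intro h hh
    have h0 : B h h = 0 := by
      have := LinearMap.congr_fun hh h
      simpa using this
    rw [hB] at h0
    have h1 := energy_self_nonneg (G := G) h
    have h2 := mul_self_nonneg (h o)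
    have h3 : h o = 0 := mul_self_eq_zero.1 (by linarith)
    funext x
    rw [Pi.zero_apply, ← h3]
    exact eq_of_energy_self_eq_zero hG (by linarith) x o
  have hsurj : Function.Surjective (B.flip : (V → ℝ) →ₗ[ℝ] Module.Dual ℝ (V → ℝ)) :=
    (LinearMap.injective_iff_surjective_of_finrank_eq_finrank
      (Subspace.dual_finrank_eq).symm).1 hinj
  choose N hN using fun y : V => hsurj (LinearMap.proj y)
  have hN' : ∀ f y, G.energy f (N y) + f o * N y o = f y := fun f y => by
    have := LinearMap.congr_fun (hN y) f
    simpa [hB] using this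
  have hone : ∀ y, N y o = 1 := fun y => by
    have := hN' (fun _ => 1) y
    rwa [energy_comm, energy_const_right, zero_add, one_mul] at this
  refine ⟨fun x y => N y x - 1, fun y => by simp [hone], fun f y => ?_⟩
  rw [energy_sub_right f (N y) fun _ => 1, energy_const_right]
  have := hN' f y
  rw [hone] at this
  linarith

namespace IsGreenKernel

variable [Fintype E] {G : WeightedGraph V E} {o : V} {M : V → V → ℝ}

theorem symm (hM : G.IsGreenKernel o M) (x y : V) : M x y = M y x := by
  have h1 := hM.energy_eq (fun z => M z x) y
  have h2 := hM.energy_eq (fun z => M z y) x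
  rw [energy_comm, h2, hM.zero_left, hM.zero_left] at h1
  linarith

theorem zero_right (hM : G.IsGreenKernel o M) (x : V) : M x o = 0 := by
  rw [hM.symm, hM.zero_left]

theorem diag_nonneg (hM : G.IsGreenKernel o M) (y : V) : 0 ≤ M y y := by
  have := energy_self_nonneg (G := G) (fun z => M z y)
  rwa [hM.energy_eq, hM.zero_left, sub_zero] at this

theorem diag_pos (hM : G.IsGreenKernel o M) (hG : G.Connected) {y : V} (hy : y ≠ o) :
    0 < M y y := by
  classical
  refine (hM.diag_nonneg y).lt_of_ne fun h0 => ?_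
  have hconst := eq_of_energy_self_eq_zero hG (f := fun z => M z y)
    (by rw [hM.energy_eq, hM.zero_left, ← h0, sub_zero])
  have h1 := hM.energy_eq (fun z => if z = y then 1 else 0) y
  rw [show (fun z => M z y) = fun _ => M o y from funext fun z => hconst z o,
    energy_const_right] at h1
  simp [hy.symm] at h1

/-- Moving the ground from `o` to `y`. -/
theorem reground (hM : G.IsGreenKernel o M) (y : V) :
    G.IsGreenKernel y (fun x z => M x z - M x y - M y z + M y y) := by
  refine ⟨fun z => by ring, fun f z => ?_⟩
  have : (fun x => M x z - M x y - M y z + M y y) =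
      fun x => (M x z - M x y) - (M y z - M y y) := funext fun x => by ring
  rw [this, energy_sub_right f (fun x => M x z - M x y) fun _ => M y z - M y y,
    energy_sub_right, energy_const_right, hM.energy_eq, hM.energy_eq]
  ring

theorem sq_le (hM : G.IsGreenKernel o M) (a b : V) : M a b ^ 2 ≤ M a a * M b b := by
  have h := energy_self_nonneg (G := G) (fun x => M b b * M x a - M a b * M x b)
  rw [energy_sub_right _ (fun x => M b b * M x a) fun x => M a b * M x b, energy_smul_right,
    energy_smul_right, hM.energy_eq, hM.energy_eq, hM.zero_left, hM.zero_left, hM.symm b a] at h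
  rcases (hM.diag_nonneg b).eq_or_lt with h0 | h0
  · by_contra! hlt
    have hm : M a b ≠ 0 := by rintro h2; simp [h2, ← h0] at hlt
    have h1 := energy_self_nonneg (G := G) (fun x => M x a - (M a a + 1) / M a b * M x b)
    rw [energy_sub_right _ (fun x => M x a) fun x => (M a a + 1) / M a b * M x b,
      energy_smul_right, hM.energy_eq, hM.energy_eq, hM.zero_left, hM.zero_left, hM.symm b a,
      ← h0, div_mul_cancel₀ _ hm] at h1
    have := hM.diag_nonneg a
    have h3 : (M a a + 1) / M a b * (M a b - (M a a + 1) / M a b * 0 -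
        (0 - (M a a + 1) / M a b * 0)) = M a a + 1 := by
      rw [mul_zero, sub_zero, sub_zero, sub_zero, div_mul_cancel₀ _ hm]
    rw [h3] at h1
    linarith
  · by_contra! hlt
    nlinarith

end IsGreenKernel
end WeightedGraph

/-! ### Effective resistances and the discrete canonical measure -/

namespace WeightedGraph

variable {V E : Type*}

/-- The effective resistance between the endpoints of the edge `e`, in terms of a Green kernel. -/
def edgeRes (G : WeightedGraph V E) (M : V → V → ℝ) (e : E) : ℝ :=
  M (G.tail e) (G.tail e) + M (G.head e) (G.head e) - 2 * M (G.tail e) (G.head e)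

/-- The Foster coefficient `L / (L + R)` of the edge `e` of length `L`, where `R` is the effective
resistance between the endpoints of `e` after the removal of `e`; as `edgeRes = L R / (L + R)`, it
equals `1 - edgeRes / L`. -/
noncomputable def foster (G : WeightedGraph V E) (M : V → V → ℝ) (e : E) : ℝ :=
  1 - G.edgeRes M e / G.len e

/-- The functional `f ↦ 2 ∫ f dw`, where `w` is the discrete canonical measure: the measure on the
vertices whose mass at `p` is `1 - ½ ∑ (1 - F e)`, the sum being over the half-edges at `p`.  Its
total mass is one, by Foster's theorem. -/
noncomputable def canon [Fintype V] [Fintype E] (G : WeightedGraph V E) (M : V → V → ℝ)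
    (f : V → ℝ) : ℝ :=
  2 * ∑ v, f v - ∑ e, (f (G.tail e) + f (G.head e)) * (1 - G.foster M e)

/-- Replace the network with terminals `y`, `tail e`, `head e` by the equivalent triangle, and let
`N` be the Green kernel grounded at `y`.  The excess is the difference between the conductance of
the side of the triangle opposite to `y` and the conductance `1 / len e` of `e` alone, multiplied by
the determinant of `N` on the endpoints of `e`.  It equals `F e * Y`, where `Y` is the resistance
between `y` and the centre of the star equivalent to the network `Γ - e` with the same terminals. -/
noncomputable def excess (G : WeightedGraph V E) (N : V → V → ℝ) (e : E) : ℝ :=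
  N (G.tail e) (G.head e) - (N (G.tail e) (G.tail e) * N (G.head e) (G.head e) -
    N (G.tail e) (G.head e) ^ 2) / G.len e

theorem sum_ite_mul_endpoint [Fintype V] [Fintype E] (f : V → ℝ) (g : E → V → ℝ) (t : E → V) :
    ∑ e, f (t e) * g e (t e) = ∑ v, f v * ∑ e, open Classical in if t e = v then g e v else 0 := by
  classical
  simp only [Finset.mul_sum]
  rw [Finset.sum_comm]
  refine Finset.sum_congr rfl fun e _ => ?_
  simp

section Canon

variable [Fintype V] [Fintype E] {G : WeightedGraph V E} {M : V → V → ℝ}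

theorem canon_add (f h : V → ℝ) :
    G.canon M (fun x => f x + h x) = G.canon M f + G.canon M h := by
  simp only [canon, Finset.sum_add_distrib, add_mul]; ring

theorem canon_mul (c : ℝ) (f : V → ℝ) : G.canon M (fun x => c * f x) = c * G.canon M f := by
  simp only [canon, mul_sub, Finset.mul_sum]
  exact congrArg₂ _ (Finset.sum_congr rfl fun _ _ => by ring)
    (Finset.sum_congr rfl fun _ _ => by ring)

end Canon

namespace IsGreenKernel

section

variable [Fintype E] {G : WeightedGraph V E} {o : V} {M : V → V → ℝ}

theorem edgeRes_le (hM : G.IsGreenKernel o M) (e : E) : G.edgeRes M e ≤ G.len e := by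
  have h : G.energy (fun x => M x (G.tail e) - M x (G.head e))
      (fun x => M x (G.tail e) - M x (G.head e)) = G.edgeRes M e := by
    rw [energy_sub_right _ (fun x => M x (G.tail e)) fun x => M x (G.head e), hM.energy_eq,
      hM.energy_eq, hM.zero_left, hM.zero_left, hM.symm (G.head e) (G.tail e), edgeRes]
    ring
  have h2 := Finset.single_le_sum
    (f := fun e' => ((M (G.tail e') (G.tail e) - M (G.tail e') (G.head e)) -
      (M (G.head e') (G.tail e) - M (G.head e') (G.head e))) *
      ((M (G.tail e') (G.tail e) - M (G.tail e') (G.head e)) -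
      (M (G.head e') (G.tail e) - M (G.head e') (G.head e))) / G.len e')
    (fun e' _ => energy_term_nonneg (G := G) (fun x => M x (G.tail e) - M x (G.head e)) e')
    (Finset.mem_univ e)
  have h3 : (M (G.tail e) (G.tail e) - M (G.tail e) (G.head e)) -
      (M (G.head e) (G.tail e) - M (G.head e) (G.head e)) = G.edgeRes M e := by
    rw [edgeRes, hM.symm (G.head e) (G.tail e)]; ring
  rw [energy] at h
  simp only [h3] at h2
  rw [h, div_le_iff₀ (G.len_pos e)] at h2
  by_contra! hlt
  have := G.len_pos e
  nlinarith

theorem foster_nonneg (hM : G.IsGreenKernel o M) (e : E) : 0 ≤ G.foster M e := by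
  rw [foster, sub_nonneg, div_le_one (G.len_pos e)]
  exact hM.edgeRes_le e

/-- The excess in terms of effective resistances. -/
theorem excess_eq (hM : G.IsGreenKernel o M) (y : V) (e : E) :
    4 * G.excess (fun x z => M x z - M x y - M y z + M y y) e =
      ((fun x => M x x + M y y - 2 * M x y) (G.tail e) -
        (fun x => M x x + M y y - 2 * M x y) (G.head e)) *
      ((fun x => M x x + M y y - 2 * M x y) (G.tail e) -
        (fun x => M x x + M y y - 2 * M x y) (G.head e)) / G.len e +
      2 * (G.foster M e * ((fun x => M x x + M y y - 2 * M x y) (G.tail e) +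
        (fun x => M x x + M y y - 2 * M x y) (G.head e))) -
      G.len e * (1 - G.foster M e ^ 2) := by
  have hL := (G.len_pos e).ne'
  simp only [excess, foster, edgeRes, hM.symm y]
  field_simp
  ring

end

variable [Fintype V] [Fintype E] {G : WeightedGraph V E} {o : V} {M : V → V → ℝ}

/-- The Laplacian of the diagonal of the Green kernel is `2 w - 2 δ_o`, where `w` is the discrete
canonical measure. -/
theorem energy_diag (hM : G.IsGreenKernel o M) (f : V → ℝ) :
    G.energy f (fun x => M x x) = G.canon M f - 2 * f o := by
  classical
  have key : ∑ e, (f (G.tail e) * (M (G.tail e) (G.tail e) - M (G.head e) (G.tail e)) / G.len e +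
      f (G.head e) * (M (G.head e) (G.head e) - M (G.tail e) (G.head e)) / G.len e) =
      ∑ v, f v - f o := by
    have h1 : ∀ v, ∑ e, ((if G.tail e = v then
        (M (G.tail e) v - M (G.head e) v) / G.len e else 0) + (if G.head e = v then
        (M (G.head e) v - M (G.tail e) v) / G.len e else 0)) = 1 - if o = v then 1 else 0 := by
      intro v
      have := hM.energy_eq (fun x => if x = v then 1 else 0) v
      rw [if_pos rfl] at this
      rw [← this, energy]
      refine Finset.sum_congr rfl fun e _ => ?_
      split_ifs <;> ring
    have h2 : ∑ v, f v * (1 - if o = v then 1 else 0) = ∑ v, f v - f o := by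
      simp [mul_sub]
    rw [← h2, Finset.sum_add_distrib]
    simp only [← h1, Finset.sum_add_distrib, mul_add]
    congr 1
    · rw [← sum_ite_mul_endpoint f
        (fun e v => (M (G.tail e) v - M (G.head e) v) / G.len e) G.tail]
      exact Finset.sum_congr rfl fun e _ => by ring
    · rw [← sum_ite_mul_endpoint f
        (fun e v => (M (G.head e) v - M (G.tail e) v) / G.len e) G.head]
      exact Finset.sum_congr rfl fun e _ => by ring
  rw [canon, show 2 * ∑ v, f v - ∑ e, (f (G.tail e) + f (G.head e)) * (1 - G.foster M e) - 2 * f o =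
    2 * (∑ v, f v - f o) - ∑ e, (f (G.tail e) + f (G.head e)) * (1 - G.foster M e) by ring,
    ← key, Finset.mul_sum, ← Finset.sum_sub_distrib, energy]
  refine Finset.sum_congr rfl fun e _ => ?_
  rw [foster, edgeRes, hM.symm (G.head e) (G.tail e)]
  ring

theorem canon_one (hM : G.IsGreenKernel o M) : G.canon M (fun _ => 1) = 2 := by
  have h := hM.energy_diag (fun _ => 1)
  rw [energy_comm, energy_const_right] at h
  linarith

theorem canon_green (hM : G.IsGreenKernel o M) (y : V) : G.canon M (fun x => M x y) = M y y := by
  have h := hM.energy_diag (fun x => M x y)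
  rw [energy_comm, hM.energy_eq, hM.zero_left, hM.zero_left] at h
  linarith

/-- Foster's theorem. -/
theorem sum_foster (hM : G.IsGreenKernel o M) :
    ∑ e, G.foster M e = Fintype.card E - Fintype.card V + 1 := by
  have h := hM.canon_one
  simp only [canon, Finset.sum_const, Finset.card_univ, nsmul_eq_mul, mul_one, mul_sub,
    Finset.sum_sub_distrib, ← Finset.mul_sum] at h
  linarith

/-- The energy of the resistance function `r(·, y)` does not depend on `y`. -/
theorem energy_resistance (hM : G.IsGreenKernel o M) (y : V) :
    G.energy (fun x => M x x + M y y - 2 * M x y) (fun x => M x x + M y y - 2 * M x y) =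
      G.canon M fun x => M x x := by
  have hc : ∀ f, G.energy f (fun x => M x x + M y y - 2 * M x y) =
      G.canon M f - 2 * f y := by
    intro f
    rw [energy_sub_right f (fun x => M x x + M y y) fun x => 2 * M x y,
      energy_add_right f (fun x => M x x) fun _ => M y y, energy_const_right, energy_smul_right,
      hM.energy_eq, hM.energy_diag]
    ring
  rw [hc]
  have h1 : (fun x => M x x + M y y - 2 * M x y) =
      fun x => (M x x + M y y * 1) + (-2) * M x y := funext fun x => by ring
  rw [h1, canon_add (fun x => M x x + M y y * 1) fun x => (-2) * M x y,
    canon_add (fun x => M x x) fun x => M y y * 1, canon_mul (M y y) (fun _ => 1), canon_mul,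
    hM.canon_one, hM.canon_green]
  ring

end IsGreenKernel

end WeightedGraph

/-! ### Continuous and piecewise affine functions on the metric graph -/

namespace WeightedGraph

variable {V E : Type*} {G : WeightedGraph V E}

theorem param_of_nonpos {e : E} {t : ℝ} (ht : t ≤ 0) : G.param e t = .vertex (G.tail e) := by
  rw [param, dif_neg (fun h => absurd h.1 ht.not_gt), if_pos ht]

theorem param_of_ge {e : E} {t : ℝ} (ht : G.len e ≤ t) : G.param e t = .vertex (G.head e) := by
  rw [param, dif_neg (fun h => absurd h.2 ht.not_gt), if_neg]
  have := G.len_pos e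
  linarith

theorem param_of_mem {e : E} {t : ℝ} (ht : t ∈ Set.Ioo 0 (G.len e)) :
    G.param e t = .inner e t ht := dif_pos ht

theorem continuous_param (e : E) : Continuous (G.param e) :=
  continuous_iff_coinduced_le.2 (le_iSup (fun e => TopologicalSpace.coinduced (G.param e) _) e)

theorem continuous_point_iff {X : Type*} [TopologicalSpace X] {f : G.Point → X} :
    Continuous f ↔ ∀ e, Continuous fun t => f (G.param e t) :=
  ⟨fun h e => h.comp (continuous_param e), fun h =>
    continuous_iSup_dom.2 fun e => continuous_coinduced_dom.2 (h e)⟩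

/-- The point of the interval `[0, len e]` closest to `t`. -/
def clamp (G : WeightedGraph V E) (e : E) (t : ℝ) : ℝ := max 0 (min t (G.len e))

theorem clamp_mem (e : E) (t : ℝ) : G.clamp e t ∈ Set.Icc 0 (G.len e) :=
  ⟨le_max_left _ _, max_le (G.len_pos e).le (min_le_right _ _)⟩

theorem clamp_of_mem {e : E} {t : ℝ} (ht : t ∈ Set.Icc 0 (G.len e)) : G.clamp e t = t := by
  rw [clamp, min_eq_left ht.2, max_eq_right ht.1]

theorem param_clamp (e : E) (t : ℝ) : G.param e (G.clamp e t) = G.param e t := by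
  have hL := G.len_pos e
  rcases le_or_gt t 0 with h | h
  · rw [param_of_nonpos h, param_of_nonpos]
    rw [clamp, min_eq_left (by linarith), max_eq_left h]
  rcases le_or_gt (G.len e) t with h' | h'
  · rw [param_of_ge h', param_of_ge]
    rw [clamp, min_eq_right h', max_eq_right hL.le]
  · rw [clamp_of_mem ⟨h.le, h'.le⟩]

theorem continuous_clamp (e : E) : Continuous (G.clamp e) := by
  unfold clamp; fun_prop

/-- A function given on every edge by a continuous function of the parameter is continuous. -/
theorem continuous_of_eq_on_edges {f : G.Point → ℝ} {φ : E → ℝ → ℝ} (hφ : ∀ e, Continuous (φ e))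
    (h : ∀ e, ∀ t ∈ Set.Icc 0 (G.len e), f (G.param e t) = φ e t) : Continuous f := by
  refine continuous_point_iff.2 fun e => ?_
  have : (fun t => f (G.param e t)) = fun t => φ e (G.clamp e t) := by
    funext t
    rw [← param_clamp, h e _ (clamp_mem e t)]
  rw [this]
  exact (hφ e).comp (continuous_clamp e)

/-- The value at a point of the metric graph of the function that is affine on the edges and equals
`f` on the vertices. -/
noncomputable def interp (f : V → ℝ) : G.Point → ℝ
  | .vertex v => f v
  | .inner e t _ => (1 - t / G.len e) * f (G.tail e) + t / G.len e * f (G.head e)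

/-- The Green function of the interval `[0, L]` with Dirichlet boundary conditions. -/
noncomputable def tent (L s t : ℝ) : ℝ := min s t * (L - max s t) / L

theorem tent_comm (L s t : ℝ) : tent L s t = tent L t s := by
  rw [tent, tent, min_comm, max_comm]

theorem tent_of_le {L s t : ℝ} (h : s ≤ t) : tent L s t = s * (L - t) / L := by
  rw [tent, min_eq_left h, max_eq_right h]

theorem tent_zero_left {L t : ℝ} (h : 0 ≤ t) : tent L 0 t = 0 := by
  rw [tent_of_le h]; ring

theorem tent_self_left {L t : ℝ} (h : t ≤ L) : tent L L t = 0 := by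
  rw [tent_comm, tent_of_le h]; ring

open Classical in
/-- For a point `y`, the function on the edge `e` that is the Dirichlet Green function with pole at
`y` when `y` lies inside `e`, and zero otherwise. -/
noncomputable def bump (G : WeightedGraph V E) (e : E) (s : ℝ) : G.Point → ℝ
  | .vertex _ => 0
  | .inner e' t _ => if e' = e then tent (G.len e) s t else 0

theorem interp_param (f : V → ℝ) {e : E} {t : ℝ} (ht : t ∈ Set.Icc 0 (G.len e)) :
    interp f (G.param e t) =
      (1 - t / G.len e) * f (G.tail e) + t / G.len e * f (G.head e) := by
  have hL := (G.len_pos e).ne'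
  rcases ht.1.eq_or_lt with rfl | h
  · rw [param_of_nonpos le_rfl]; simp [interp]
  rcases ht.2.eq_or_lt with rfl | h'
  · rw [param_of_ge le_rfl]; simp [interp, hL]
  · rw [param_of_mem ⟨h, h'⟩]; rfl

theorem bump_zero (e : E) (y : G.Point) : G.bump e 0 y = 0 := by
  rcases y with v | ⟨e', t, ht⟩
  · rfl
  · rw [bump]; split_ifs with h
    · exact tent_zero_left ht.1.le
    · rfl

theorem bump_len (e : E) (y : G.Point) : G.bump e (G.len e) y = 0 := by
  rcases y with v | ⟨e', t, ht⟩
  · rfl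
  · rw [bump]; split_ifs with h
    · subst h; exact tent_self_left ht.2.le
    · rfl

/-- The Green kernel of the metric graph grounded at the vertex `o`, in terms of the discrete Green
kernel `M`: bilinear interpolation, plus the Dirichlet Green function of the edge when both points
lie on the same edge. -/
noncomputable def kernel (G : WeightedGraph V E) (M : V → V → ℝ) : G.Point → G.Point → ℝ
  | .vertex u, y => interp (M u) y
  | .inner e s _, y => (1 - s / G.len e) * interp (M (G.tail e)) y +
      s / G.len e * interp (M (G.head e)) y + G.bump e s y

theorem kernel_param (M : V → V → ℝ) {e : E} {t : ℝ} (ht : t ∈ Set.Icc 0 (G.len e))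
    (y : G.Point) : G.kernel M (G.param e t) y =
      (1 - t / G.len e) * interp (M (G.tail e)) y + t / G.len e * interp (M (G.head e)) y +
        G.bump e t y := by
  have hL := (G.len_pos e).ne'
  rcases ht.1.eq_or_lt with rfl | h
  · rw [param_of_nonpos le_rfl, bump_zero]; simp [kernel]
  rcases ht.2.eq_or_lt with rfl | h'
  · rw [param_of_ge le_rfl, bump_len]; simp [kernel, hL]
  · rw [param_of_mem ⟨h, h'⟩]; rfl

theorem kernel_vertex_left (M : V → V → ℝ) (v : V) (y : G.Point) :
    G.kernel M (.vertex v) y = interp (M v) y := rfl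

theorem kernel_comm {M : V → V → ℝ} (hM : ∀ u v, M u v = M v u) (x y : G.Point) :
    G.kernel M x y = G.kernel M y x := by
  rcases x with u | ⟨e, s, hs⟩ <;> rcases y with v | ⟨e', t, ht⟩ <;>
    simp only [kernel, interp, bump]
  · rw [hM]
  · rw [hM u, hM u, add_zero]
  · rw [hM v, hM v, add_zero]
  · rw [hM (G.tail e) (G.tail e'), hM (G.tail e) (G.head e'), hM (G.head e) (G.tail e'),
      hM (G.head e) (G.head e')]
    by_cases h : e' = e
    · subst h
      rw [if_pos rfl, if_pos rfl, tent_comm]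
      ring
    · rw [if_neg h, if_neg (Ne.symm h)]
      ring

theorem continuous_bump (e : E) (y : G.Point) : Continuous fun s => G.bump e s y := by
  rcases y with v | ⟨e', t, ht⟩
  · exact continuous_const
  · by_cases h : e' = e
    · simp only [bump, h, if_true, tent]; fun_prop
    · simp only [bump, h, if_false]; exact continuous_const

theorem continuous_kernel_left (M : V → V → ℝ) (y : G.Point) :
    Continuous fun x => G.kernel M x y :=
  continuous_of_eq_on_edges
    (fun e => by have := continuous_bump e y; fun_prop) fun e t ht => kernel_param M ht y

section Slopes

theorem hasDerivWithinAt_affine_Ici {F : ℝ → ℝ} {t b c d : ℝ} (hb : t < b)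
    (h : ∀ s ∈ Set.Icc t b, F s = c * s + d) : HasDerivWithinAt F c (Set.Ici t) t := by
  have h1 : HasDerivWithinAt (fun s => c * s + d) c (Set.Icc t b) t := by
    simpa using (((hasDerivAt_id t).const_mul c).add_const d).hasDerivWithinAt
  exact (h1.congr h (h t ⟨le_rfl, hb.le⟩)).mono_of_mem_nhdsWithin (Icc_mem_nhdsGE hb)

theorem hasDerivWithinAt_affine_Iic {F : ℝ → ℝ} {t a c d : ℝ} (ha : a < t)
    (h : ∀ s ∈ Set.Icc a t, F s = c * s + d) : HasDerivWithinAt F c (Set.Iic t) t := by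
  have h1 : HasDerivWithinAt (fun s => c * s + d) c (Set.Icc a t) t := by
    simpa using (((hasDerivAt_id t).const_mul c).add_const d).hasDerivWithinAt
  exact (h1.congr h (h t ⟨ha.le, le_rfl⟩)).mono_of_mem_nhdsWithin (Icc_mem_nhdsLE ha)

/-- A finite set of reals leaves a free interval to the right of every point. -/
theorem exists_gap_right (S : Finset ℝ) {t L : ℝ} (h : t < L) :
    ∃ b, t < b ∧ b ≤ L ∧ ∀ s ∈ S, s ∉ Set.Ioo t b := by
  have hne : ((insert L S).filter (t < ·)).Nonempty := ⟨L, by simp [h]⟩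
  have hmem := Finset.mem_filter.1 (Finset.min'_mem _ hne)
  refine ⟨_, hmem.2, Finset.min'_le _ _ (by simp [h]), fun s hs hst => ?_⟩
  exact absurd (Finset.min'_le _ s (by simp [hs, hst.1])) hst.2.not_ge

theorem exists_gap_left (S : Finset ℝ) {t : ℝ} (h : 0 < t) :
    ∃ a, 0 ≤ a ∧ a < t ∧ ∀ s ∈ S, s ∉ Set.Ioo a t := by
  have hne : ((insert 0 S).filter (· < t)).Nonempty := ⟨0, by simp [h]⟩
  have hmem := Finset.mem_filter.1 (Finset.max'_mem _ hne)
  refine ⟨_, Finset.le_max' _ _ (by simp [h]), hmem.2, fun s hs hst => ?_⟩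
  exact absurd (Finset.le_max' _ s (by simp [hs, hst.2])) hst.1.not_ge

theorem PiecewiseAffine.exists_right {f : G.Point → ℝ} (hf : G.PiecewiseAffine f) (e : E)
    {t : ℝ} (h0 : 0 ≤ t) (h : t < G.len e) : ∃ b c d, t < b ∧ b ≤ G.len e ∧
      ∀ s ∈ Set.Icc t b, f (G.param e s) = c * s + d := by
  obtain ⟨S, hS⟩ := hf e
  obtain ⟨b, hb, hbL, hgap⟩ := exists_gap_right S h
  obtain ⟨c, d, hcd⟩ := hS t b h0 hb hbL hgap
  exact ⟨b, c, d, hb, hbL, hcd⟩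

theorem PiecewiseAffine.exists_left {f : G.Point → ℝ} (hf : G.PiecewiseAffine f) (e : E)
    {t : ℝ} (h0 : 0 < t) (h : t ≤ G.len e) : ∃ a c d, 0 ≤ a ∧ a < t ∧
      ∀ s ∈ Set.Icc a t, f (G.param e s) = c * s + d := by
  obtain ⟨S, hS⟩ := hf e
  obtain ⟨a, ha0, ha, hgap⟩ := exists_gap_left S h0
  obtain ⟨c, d, hcd⟩ := hS a t ha0 ha h hgap
  exact ⟨a, c, d, ha0, ha, hcd⟩

theorem PiecewiseAffine.differentiable_right {f : G.Point → ℝ} (hf : G.PiecewiseAffine f) (e : E)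
    {t : ℝ} (h0 : 0 ≤ t) (h : t < G.len e) :
    DifferentiableWithinAt ℝ (fun s => f (G.param e s)) (Set.Ici t) t := by
  obtain ⟨b, c, d, hb, -, hcd⟩ := hf.exists_right e h0 h
  exact (hasDerivWithinAt_affine_Ici hb hcd).differentiableWithinAt

theorem PiecewiseAffine.differentiable_left {f : G.Point → ℝ} (hf : G.PiecewiseAffine f) (e : E)
    {t : ℝ} (h0 : 0 < t) (h : t ≤ G.len e) :
    DifferentiableWithinAt ℝ (fun s => f (G.param e s)) (Set.Iic t) t := by
  obtain ⟨a, c, d, -, ha, hcd⟩ := hf.exists_left e h0 h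
  exact (hasDerivWithinAt_affine_Iic ha hcd).differentiableWithinAt

theorem PiecewiseAffine.sub {f h : G.Point → ℝ} (hf : G.PiecewiseAffine f)
    (hh : G.PiecewiseAffine h) : G.PiecewiseAffine fun x => f x - h x := by
  classical
  intro e
  obtain ⟨S, hS⟩ := hf e
  obtain ⟨T, hT⟩ := hh e
  refine ⟨S ∪ T, fun a b h0 hab hb hST => ?_⟩
  obtain ⟨c, d, h1⟩ := hS a b h0 hab hb fun s hs => hST s (Finset.mem_union_left _ hs)
  obtain ⟨c', d', h2⟩ := hT a b h0 hab hb fun s hs => hST s (Finset.mem_union_right _ hs)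
  exact ⟨c - c', d - d', fun t ht => by
    change f _ - h _ = _
    rw [h1 t ht, h2 t ht]; ring⟩

theorem outSlopeSum_sub [Fintype E] {f h : G.Point → ℝ} (hf : G.PiecewiseAffine f)
    (hh : G.PiecewiseAffine h) (p : G.Point) :
    G.outSlopeSum (fun x => f x - h x) p = G.outSlopeSum f p - G.outSlopeSum h p := by
  have hr : ∀ e t, 0 ≤ t → t < G.len e →
      derivWithin (fun s => f (G.param e s) - h (G.param e s)) (Set.Ici t) t =
      derivWithin (fun s => f (G.param e s)) (Set.Ici t) t -
        derivWithin (fun s => h (G.param e s)) (Set.Ici t) t := fun e t h0 hL =>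
    derivWithin_fun_sub (hf.differentiable_right e h0 hL) (hh.differentiable_right e h0 hL)
  have hl : ∀ e t, 0 < t → t ≤ G.len e →
      derivWithin (fun s => f (G.param e s) - h (G.param e s)) (Set.Iic t) t =
      derivWithin (fun s => f (G.param e s)) (Set.Iic t) t -
        derivWithin (fun s => h (G.param e s)) (Set.Iic t) t := fun e t h0 hL =>
    derivWithin_fun_sub (hf.differentiable_left e h0 hL) (hh.differentiable_left e h0 hL)
  rcases p with v | ⟨e, t, ht⟩
  · simp only [outSlopeSum]
    rw [add_sub_add_comm, ← Finset.sum_sub_distrib, ← Finset.sum_sub_distrib]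
    congr 1 <;> refine Finset.sum_congr rfl fun e _ => ?_
    · rw [hr e 0 le_rfl (G.len_pos e)]; split_ifs <;> ring
    · rw [hl e _ (G.len_pos e) le_rfl]; split_ifs <;> ring
  · simp only [outSlopeSum]
    rw [hr e t ht.1.le ht.2, hl e t ht.1 ht.2.le]
    ring

/-- A piecewise affine function whose left and right slopes agree inside the edges is affine on
every edge. -/
theorem PiecewiseAffine.affine_of_outSlopeSum [Fintype E] {f : G.Point → ℝ}
    (hf : G.PiecewiseAffine f) (hc : Continuous f)
    (h : ∀ e t ht, G.outSlopeSum f (.inner e t ht) = 0) (e : E) :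
    ∃ c, ∀ t ∈ Set.Icc 0 (G.len e), f (G.param e t) = f (.vertex (G.tail e)) + c * t := by
  set F : ℝ → ℝ := fun s => f (G.param e s) with hF
  have hL := G.len_pos e
  have hloc : ∀ t ∈ Set.Ioo 0 (G.len e), ∃ c, ∀ᶠ s in nhds t, HasDerivAt F c s := by
    intro t ht
    obtain ⟨b, c, d, hb, -, hr⟩ := hf.exists_right e ht.1.le ht.2
    obtain ⟨a, c', d', -, ha, hl⟩ := hf.exists_left e ht.1 ht.2.le
    have h1 := h e t ht
    simp only [outSlopeSum] at h1
    rw [(hasDerivWithinAt_affine_Ici hb hr).derivWithin (uniqueDiffWithinAt_Ici t),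
      (hasDerivWithinAt_affine_Iic ha hl).derivWithin (uniqueDiffWithinAt_Iic t), sub_eq_zero]
      at h1
    subst h1
    have hd : d = d' := by
      have := hr t ⟨le_rfl, hb.le⟩
      rw [hl t ⟨ha.le, le_rfl⟩] at this
      linarith
    subst hd
    refine ⟨c, ?_⟩
    filter_upwards [Ioo_mem_nhds ha hb] with s hs
    have h2 : HasDerivAt (fun s => c * s + d) c s := by
      simpa using ((hasDerivAt_id s).const_mul c).add_const d
    refine h2.congr_of_eventuallyEq ?_
    filter_upwards [Ioo_mem_nhds hs.1 hs.2] with x hx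
    rcases le_total x t with hxt | hxt
    · exact hl x ⟨hx.1.le, hxt⟩
    · exact hr x ⟨hxt, hx.2.le⟩
  -- The derivative is locally constant on the open edge, hence constant.
  obtain ⟨c, hc'⟩ : ∃ c, ∀ t ∈ Set.Ioo 0 (G.len e), HasDerivAt F c t := by
    have hmid : G.len e / 2 ∈ Set.Ioo 0 (G.len e) := ⟨by linarith, by linarith⟩
    have hd : ∀ t ∈ Set.Ioo 0 (G.len e), DifferentiableAt ℝ F t ∧ HasDerivAt (deriv F) 0 t := by
      intro t ht
      obtain ⟨c, hc⟩ := hloc t ht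
      refine ⟨hc.self_of_nhds.differentiableAt, ?_⟩
      refine (hasDerivAt_const t c).congr_of_eventuallyEq ?_
      filter_upwards [hc] with s hs using hs.deriv
    refine ⟨deriv F (G.len e / 2), fun t ht => ?_⟩
    have := isOpen_Ioo.is_const_of_deriv_eq_zero isPreconnected_Ioo
      (fun t ht => (hd t ht).2.differentiableAt.differentiableWithinAt)
      (fun t ht => (hd t ht).2.deriv) ht hmid
    rw [← this]
    exact (hd t ht).1.hasDerivAt
  have hcont : Continuous F := hc.comp (continuous_param e)
  refine ⟨c, fun t ht => ?_⟩
  have hconst : ∀ t ∈ Set.Icc 0 (G.len e), F t - c * t = F 0 - c * 0 := by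
    refine constant_of_has_deriv_right_zero (by fun_prop) fun t ht => ?_
    rcases ht.1.eq_or_lt with rfl | h0
    · obtain ⟨b, c', d, hb, hbL, hr⟩ := hf.exists_right e le_rfl hL
      have h1 := hasDerivWithinAt_affine_Ici hb hr
      have hm : b / 2 ∈ Set.Ioo 0 (G.len e) := ⟨by linarith, by linarith⟩
      have h2 : HasDerivAt F c' (b / 2) := by
        have h3 : HasDerivAt (fun s => c' * s + d) c' (b / 2) := by
          simpa using ((hasDerivAt_id (b / 2)).const_mul c').add_const d
        refine h3.congr_of_eventuallyEq ?_
        filter_upwards [Ioo_mem_nhds (a := 0) (b := b) (by linarith) (by linarith)] with x hx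
        exact hr x ⟨hx.1.le, hx.2.le⟩
      have h3 := (hc' _ hm).unique h2
      subst h3
      have h4 : HasDerivWithinAt (fun t => c * t) c (Set.Ici 0) 0 := by
        simpa using (((hasDerivAt_id (0 : ℝ)).const_mul c).hasDerivWithinAt)
      have h5 := h1.sub h4
      rwa [sub_self] at h5
    · change HasDerivWithinAt (F - fun t => c * t) 0 _ _
      simpa using ((hc' t ⟨h0, ht.2⟩).sub ((hasDerivAt_id t).const_mul c)).hasDerivWithinAt
  have h1 := hconst t ht
  have h0 : F 0 = f (.vertex (G.tail e)) := by rw [hF]; simp only [param_of_nonpos le_rfl]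
  rw [mul_zero, sub_zero, h0] at h1
  linarith

end Slopes

end WeightedGraph

/-! ### The kernel of the metric graph and the `j`-function -/

namespace WeightedGraph

variable {V E : Type*} {G : WeightedGraph V E}

theorem hasDerivWithinAt_tent_Ici {L : ℝ} (s t : ℝ) :
    HasDerivWithinAt (fun s => tent L s t) (if s < t then (L - t) / L else -(t / L))
      (Set.Ici s) s := by
  split_ifs with h
  · refine hasDerivWithinAt_affine_Ici (d := 0) h fun x hx => ?_
    rw [tent_of_le hx.2]; ring
  · refine hasDerivWithinAt_affine_Ici (b := s + 1) (d := t * L / L) (by linarith) fun x hx => ?_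
    rw [tent_comm, tent_of_le (by linarith [hx.1, not_lt.1 h])]; ring

theorem hasDerivWithinAt_tent_Iic {L : ℝ} (s t : ℝ) :
    HasDerivWithinAt (fun s => tent L s t) (if s ≤ t then (L - t) / L else -(t / L))
      (Set.Iic s) s := by
  split_ifs with h
  · refine hasDerivWithinAt_affine_Iic (a := s - 1) (d := 0) (by linarith) fun x hx => ?_
    rw [tent_of_le (by linarith [hx.2])]; ring
  · refine hasDerivWithinAt_affine_Iic (d := t * L / L) (not_le.1 h) fun x hx => ?_
    rw [tent_comm, tent_of_le hx.1]; ring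

theorem hasDerivAt_edge_affine (L A B s : ℝ) :
    HasDerivAt (fun s => (1 - s / L) * A + s / L * B) ((B - A) / L) s := by
  have h1 : (fun s => (1 - s / L) * A + s / L * B) = fun s => (B - A) / L * s + A := by
    funext s; ring
  rw [h1]
  simpa using ((hasDerivAt_id s).const_mul ((B - A) / L)).add_const A

theorem hasDerivWithinAt_kernel_Ici (M : V → V → ℝ) (y : G.Point) {e : E} {s r : ℝ}
    (h0 : 0 ≤ s) (hL : s < G.len e)
    (hr : HasDerivWithinAt (fun s => G.bump e s y) r (Set.Ici s) s) :
    HasDerivWithinAt (fun s => G.kernel M (G.param e s) y)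
      ((interp (M (G.head e)) y - interp (M (G.tail e)) y) / G.len e + r) (Set.Ici s) s := by
  have h1 := (hasDerivAt_edge_affine (G.len e) (interp (M (G.tail e)) y)
    (interp (M (G.head e)) y) s).hasDerivWithinAt.add hr
  refine h1.congr_of_eventuallyEq ?_ (kernel_param M ⟨h0, hL.le⟩ y)
  filter_upwards [Icc_mem_nhdsGE hL] with x hx
  exact kernel_param M ⟨h0.trans hx.1, hx.2⟩ y

theorem hasDerivWithinAt_kernel_Iic (M : V → V → ℝ) (y : G.Point) {e : E} {s l : ℝ}
    (h0 : 0 < s) (hL : s ≤ G.len e)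
    (hl : HasDerivWithinAt (fun s => G.bump e s y) l (Set.Iic s) s) :
    HasDerivWithinAt (fun s => G.kernel M (G.param e s) y)
      ((interp (M (G.head e)) y - interp (M (G.tail e)) y) / G.len e + l) (Set.Iic s) s := by
  have h1 := (hasDerivAt_edge_affine (G.len e) (interp (M (G.tail e)) y)
    (interp (M (G.head e)) y) s).hasDerivWithinAt.add hl
  refine h1.congr_of_eventuallyEq ?_ (kernel_param M ⟨h0.le, hL⟩ y)
  filter_upwards [Icc_mem_nhdsLE h0] with x hx
  exact kernel_param M ⟨hx.1, hx.2.trans hL⟩ y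

theorem bump_affine (e : E) (y : G.Point) : ∃ S : Finset ℝ, ∀ a b : ℝ,
    (∀ s ∈ S, s ∉ Set.Ioo a b) → ∃ c d : ℝ, ∀ t ∈ Set.Icc a b, G.bump e t y = c * t + d := by
  rcases y with v | ⟨e', t, ht⟩
  · exact ⟨∅, fun a b _ => ⟨0, 0, fun t _ => by simp [bump]⟩⟩
  by_cases h : e' = e
  · refine ⟨{t}, fun a b hab => ?_⟩
    have := hab t (Finset.mem_singleton_self t)
    simp only [bump, h, if_true]
    rcases le_or_gt t a with hta | hta
    · refine ⟨-(t / G.len e), t * G.len e / G.len e, fun x hx => ?_⟩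
      rw [tent_comm, tent_of_le (hta.trans hx.1)]; ring
    · have htb : b ≤ t := not_lt.1 fun h => this ⟨hta, h⟩
      refine ⟨(G.len e - t) / G.len e, 0, fun x hx => ?_⟩
      rw [tent_of_le (hx.2.trans htb)]; ring
  · exact ⟨∅, fun a b _ => ⟨0, 0, fun t _ => by simp [bump, h]⟩⟩

theorem piecewiseAffine_kernel (M : V → V → ℝ) (y : G.Point) :
    G.PiecewiseAffine fun x => G.kernel M x y := by
  intro e
  obtain ⟨S, hS⟩ := bump_affine e y
  refine ⟨S, fun a b h0 _ hb hab => ?_⟩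
  obtain ⟨c, d, hcd⟩ := hS a b hab
  refine ⟨(interp (M (G.head e)) y - interp (M (G.tail e)) y) / G.len e + c,
    interp (M (G.tail e)) y + d, fun t ht => ?_⟩
  change G.kernel M (G.param e t) y = _
  rw [kernel_param M ⟨h0.trans ht.1, ht.2.trans hb⟩, hcd t ht]
  ring

theorem energy_interp [Fintype E] {o : V} {M : V → V → ℝ} (hM : G.IsGreenKernel o M) (f : V → ℝ)
    (y : G.Point) : G.energy f (fun x => interp (M x) y) = interp f y - f o := by
  rcases y with v | ⟨e, t, ht⟩
  · exact hM.energy_eq f v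
  · simp only [interp]
    rw [energy_add_right f (fun x => (1 - t / G.len e) * M x (G.tail e)) fun x =>
      t / G.len e * M x (G.head e), energy_smul_right, energy_smul_right, hM.energy_eq,
      hM.energy_eq]
    ring

open Classical in
/-- The Laplacian of the kernel is `δ_y - δ_o`. -/
theorem outSlopeSum_kernel [Fintype E] {o : V} {M : V → V → ℝ} (hM : G.IsGreenKernel o M)
    (y p : G.Point) : -G.outSlopeSum (fun x => G.kernel M x y) p =
      (if p = y then 1 else 0) - if p = .vertex o then 1 else 0 := by
  rcases p with v | ⟨e, s, hs⟩
  · have hE := energy_interp hM (fun x => if x = v then 1 else 0) y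
    simp only [outSlopeSum]
    have hmain : ∀ r l : E → ℝ,
        (∀ e, HasDerivWithinAt (fun s => G.bump e s y) (r e) (Set.Ici 0) 0) →
        (∀ e, HasDerivWithinAt (fun s => G.bump e s y) (l e) (Set.Iic (G.len e)) (G.len e)) →
        -((∑ e, if G.tail e = v then
          derivWithin (fun t => G.kernel M (G.param e t) y) (Set.Ici 0) 0 else 0) +
        ∑ e, if G.head e = v then -derivWithin (fun t => G.kernel M (G.param e t) y)
          (Set.Iic (G.len e)) (G.len e) else 0) =
        interp (fun x => if x = v then 1 else 0) y - (if o = v then 1 else 0) -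
          ∑ e, ((if G.tail e = v then r e else 0) - if G.head e = v then l e else 0) := by
      intro r l hr hl
      rw [← hE, energy, ← Finset.sum_add_distrib, ← Finset.sum_neg_distrib,
        ← Finset.sum_sub_distrib]
      refine Finset.sum_congr rfl fun e _ => ?_
      rw [(hasDerivWithinAt_kernel_Ici M y le_rfl (G.len_pos e) (hr e)).derivWithin
          (uniqueDiffWithinAt_Ici _),
        (hasDerivWithinAt_kernel_Iic M y (G.len_pos e) le_rfl (hl e)).derivWithin
          (uniqueDiffWithinAt_Iic _)]
      split_ifs <;> ring
    rcases y with u | ⟨e, t, ht⟩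
    · rw [hmain (fun _ => 0) (fun _ => 0) (fun e => hasDerivWithinAt_const _ _ _)
        (fun e => hasDerivWithinAt_const _ _ _)]
      simp [interp, eq_comm]
    · rw [hmain (fun e' => if e = e' then (G.len e' - t) / G.len e' else 0)
        (fun e' => if e = e' then -(t / G.len e') else 0)]
      · have hL := (G.len_pos e).ne'
        have h1 : ∀ e', ((if G.tail e' = v then if e = e' then (G.len e' - t) / G.len e' else 0
            else 0) - if G.head e' = v then if e = e' then -(t / G.len e') else 0 else 0) =
            if e = e' then (if G.tail e' = v then (G.len e' - t) / G.len e' else 0) +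
              (if G.head e' = v then t / G.len e' else 0) else 0 := by
          intro e'; split_ifs <;> ring
        simp only [h1, Finset.sum_ite_eq, Finset.mem_univ, if_true, interp, reduceCtorEq,
          if_false, Point.vertex.injEq, eq_comm (a := v)]
        rw [sub_div, div_self hL]
        split_ifs <;> ring
      · intro e'
        by_cases h : e = e'
        · simp only [bump, h, if_true]
          have := hasDerivWithinAt_tent_Ici (L := G.len e') 0 t
          rwa [if_pos ht.1] at this
        · simp only [bump, h, if_false]
          exact hasDerivWithinAt_const _ _ _
      · intro e'
        by_cases h : e = e'
        · simp only [bump, h, if_true]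
          have := hasDerivWithinAt_tent_Iic (L := G.len e') (G.len e') t
          rwa [if_neg (by rw [← h]; exact not_le.2 ht.2)] at this
        · simp only [bump, h, if_false]
          exact hasDerivWithinAt_const _ _ _
  · simp only [outSlopeSum]
    have hmain : ∀ r l, HasDerivWithinAt (fun s => G.bump e s y) r (Set.Ici s) s →
        HasDerivWithinAt (fun s => G.bump e s y) l (Set.Iic s) s →
        -(derivWithin (fun s => G.kernel M (G.param e s) y) (Set.Ici s) s -
          derivWithin (fun s => G.kernel M (G.param e s) y) (Set.Iic s) s) = l - r := by
      intro r l hr hl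
      rw [(hasDerivWithinAt_kernel_Ici M y hs.1.le hs.2 hr).derivWithin
          (uniqueDiffWithinAt_Ici _),
        (hasDerivWithinAt_kernel_Iic M y hs.1 hs.2.le hl).derivWithin
          (uniqueDiffWithinAt_Iic _)]
      ring
    rcases y with u | ⟨e', t, ht⟩
    · rw [hmain 0 0 (hasDerivWithinAt_const _ _ _) (hasDerivWithinAt_const _ _ _)]
      simp
    by_cases h : e' = e
    · subst h
      have h1 := hasDerivWithinAt_tent_Ici (L := G.len e') s t
      have h2 := hasDerivWithinAt_tent_Iic (L := G.len e') s t
      rw [hmain _ _ (by simpa only [bump, if_true] using h1)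
        (by simpa only [bump, if_true] using h2)]
      have hL := (G.len_pos e').ne'
      rcases lt_trichotomy s t with hst | rfl | hst
      · simp [hst, hst.le, hst.ne]
      · simp only [le_refl, if_true, lt_irrefl, if_false, reduceCtorEq]
        field_simp; ring
      · simp [hst.not_gt, hst.not_ge, hst.ne']
    · rw [hmain 0 0 (by simpa only [bump, h, if_false] using hasDerivWithinAt_const _ _ _)
        (by simpa only [bump, h, if_false] using hasDerivWithinAt_const _ _ _)]
      simp [Ne.symm h]

theorem IsJFunction.eq [Fintype V] [Fintype E] (hG : G.Connected) {z y : G.Point}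
    {f h : G.Point → ℝ} (hf : G.IsJFunction z y f) (hh : G.IsJFunction z y h) : f = h := by
  classical
  obtain ⟨hf1, hf2, hf3, hf4⟩ := hf
  obtain ⟨hh1, hh2, hh3, hh4⟩ := hh
  set d : G.Point → ℝ := fun x => f x - h x with hd
  have hslope : ∀ p, G.outSlopeSum d p = 0 := fun p => by
    rw [hd, outSlopeSum_sub hf2 hh2]
    have := hf3 p
    rw [← hh3 p] at this
    linarith
  have hPA : G.PiecewiseAffine d := hf2.sub hh2
  choose c hc using hPA.affine_of_outSlopeSum (hf1.sub hh1) fun e t ht => hslope _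
  have hce : ∀ e, c e * G.len e = d (.vertex (G.head e)) - d (.vertex (G.tail e)) := fun e => by
    have := hc e (G.len e) ⟨(G.len_pos e).le, le_rfl⟩
    rw [param_of_ge le_rfl] at this
    linarith
  have hvert : ∀ v, ∑ e, (if G.tail e = v then c e else 0) +
      ∑ e, (if G.head e = v then -c e else 0) = 0 := fun v => by
    refine Eq.trans ?_ (hslope (.vertex v))
    simp only [outSlopeSum]
    congr 1 <;> refine Finset.sum_congr rfl fun e _ => ?_
    · rw [(hasDerivWithinAt_affine_Ici (F := fun t => d (G.param e t))
        (c := c e) (d := d (.vertex (G.tail e))) (G.len_pos e)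
        fun s hs => by rw [hc e s hs]; ring).derivWithin (uniqueDiffWithinAt_Ici _)]
    · rw [(hasDerivWithinAt_affine_Iic (F := fun t => d (G.param e t))
        (c := c e) (d := d (.vertex (G.tail e))) (G.len_pos e)
        fun s hs => by rw [hc e s hs]; ring).derivWithin (uniqueDiffWithinAt_Iic _)]
  have hen : G.energy (fun v => d (.vertex v)) (fun v => d (.vertex v)) = 0 := by
    have h1 := sum_ite_mul_endpoint (fun v => d (.vertex v)) (fun e _ => c e) G.tail
    have h2 := sum_ite_mul_endpoint (fun v => d (.vertex v)) (fun e _ => -c e) G.head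
    have h3 : G.energy (fun v => d (.vertex v)) (fun v => d (.vertex v)) =
        -(∑ e, d (.vertex (G.tail e)) * c e + ∑ e, d (.vertex (G.head e)) * -c e) := by
      rw [energy, ← Finset.sum_add_distrib, ← Finset.sum_neg_distrib]
      refine Finset.sum_congr rfl fun e _ => ?_
      rw [div_eq_iff (G.len_pos e).ne']
      linear_combination (d (.vertex (G.tail e)) - d (.vertex (G.head e))) * hce e
    rw [h3, h1, h2, ← Finset.sum_add_distrib, neg_eq_zero]
    refine Finset.sum_eq_zero fun v _ => ?_
    rw [← mul_add, hvert, mul_zero]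
  have hconst := eq_of_energy_self_eq_zero hG hen
  have hc0 : ∀ e, c e = 0 := fun e => by
    have := hce e
    rw [hconst (G.head e) (G.tail e), sub_self] at this
    exact (mul_eq_zero.1 this).resolve_right (G.len_pos e).ne'
  obtain ⟨v₀⟩ := hG.nonempty
  have hall : ∀ x, d x = d (.vertex v₀) := by
    rintro (v | ⟨e, t, ht⟩)
    · exact hconst v v₀
    · have := hc e t ⟨ht.1.le, ht.2.le⟩
      rw [param_of_mem ht, hc0, zero_mul, add_zero] at this
      rw [this]
      exact hconst _ _
  funext x
  have hz : d z = 0 := by rw [hd]; simp only [hf4, hh4, sub_self]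
  have hx : d x = 0 := by rw [hall x, ← hall z, hz]
  exact sub_eq_zero.1 hx

theorem isJFunction_kernel [Fintype E] {o : V} {M : V → V → ℝ} (hM : G.IsGreenKernel o M)
    (z y : G.Point) : G.IsJFunction z y fun x =>
      (G.kernel M x y - G.kernel M x z) - (G.kernel M z y - G.kernel M z z) := by
  have hconst : G.PiecewiseAffine fun _ => G.kernel M z y - G.kernel M z z := fun e =>
    ⟨∅, fun a b _ _ _ _ => ⟨0, G.kernel M z y - G.kernel M z z, fun t _ => by simp⟩⟩
  have hsub := (piecewiseAffine_kernel M y).sub (piecewiseAffine_kernel M z)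
  refine ⟨((continuous_kernel_left M y).sub (continuous_kernel_left M z)).sub continuous_const,
    hsub.sub hconst, fun p => ?_, by ring⟩
  have h0 : G.outSlopeSum (fun _ => G.kernel M z y - G.kernel M z z) p = 0 := by
    rcases p with v | ⟨e, t, ht⟩ <;> simp [outSlopeSum]
  rw [outSlopeSum_sub hsub hconst, outSlopeSum_sub (piecewiseAffine_kernel M y)
    (piecewiseAffine_kernel M z), h0]
  have h1 := outSlopeSum_kernel hM y p
  have h2 := outSlopeSum_kernel hM z p
  linarith

theorem j_eq_kernel [Fintype V] [Fintype E] (hG : G.Connected) {o : V} {M : V → V → ℝ}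
    (hM : G.IsGreenKernel o M) (z x y : G.Point) : G.j z x y =
      G.kernel M x y - G.kernel M x z - (G.kernel M z y - G.kernel M z z) :=
  congrFun (IsJFunction.eq hG (Classical.epsilon_spec (⟨_, isJFunction_kernel hM z y⟩ :
    ∃ f, G.IsJFunction z y f)) (isJFunction_kernel hM z y)) x

end WeightedGraph

/-! ### Potentials of measures and the Green's function -/

namespace WeightedGraph

variable {V E : Type*} {G : WeightedGraph V E}

theorem kernel_inner_self {o : V} [Fintype E] {M : V → V → ℝ} (hM : G.IsGreenKernel o M) (e : E)
    (t : ℝ) (ht : t ∈ Set.Ioo 0 (G.len e)) :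
    G.kernel M (.inner e t ht) (.inner e t ht) =
      interp (fun v => M v v) (.inner e t ht : G.Point) +
        G.foster M e / G.len e * (t * (G.len e - t)) := by
  have hL := (G.len_pos e).ne'
  simp only [kernel, interp, bump, if_true, tent_of_le le_rfl, foster, edgeRes,
    hM.symm (G.head e) (G.tail e)]
  field_simp
  ring

theorem kernel_param_self {o : V} [Fintype E] {M : V → V → ℝ} (hM : G.IsGreenKernel o M) {e : E}
    {t : ℝ} (ht : t ∈ Set.Icc 0 (G.len e)) :
    G.kernel M (G.param e t) (G.param e t) =
      (1 - t / G.len e) * M (G.tail e) (G.tail e) + t / G.len e * M (G.head e) (G.head e) +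
        G.foster M e / G.len e * (t * (G.len e - t)) := by
  have hL := (G.len_pos e).ne'
  rcases ht.1.eq_or_lt with rfl | h
  · rw [param_of_nonpos le_rfl]; simp [kernel, interp]
  rcases ht.2.eq_or_lt with rfl | h'
  · rw [param_of_ge le_rfl]; simp [kernel, interp, hL]
  · rw [param_of_mem ⟨h, h'⟩]; exact kernel_inner_self hM e t ⟨h, h'⟩

theorem continuous_kernel_self {o : V} [Fintype E] {M : V → V → ℝ} (hM : G.IsGreenKernel o M) :
    Continuous fun x => G.kernel M x x :=
  continuous_of_eq_on_edges (fun e => by fun_prop) fun e t ht => kernel_param_self hM ht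

theorem abs_interp_le {f : V → ℝ} {C : ℝ} (h : ∀ v, |f v| ≤ C) (x : G.Point) :
    |interp f x| ≤ C := by
  rcases x with v | ⟨e, t, ht⟩
  · exact h v
  · have h1 : 0 ≤ t / G.len e := div_nonneg ht.1.le (G.len_pos e).le
    have h2 : t / G.len e ≤ 1 := (div_le_one (G.len_pos e)).2 ht.2.le
    have h3 := abs_le.1 (h (G.tail e))
    have h4 := abs_le.1 (h (G.head e))
    simp only [interp]
    rw [abs_le]
    constructor <;> nlinarith

theorem abs_tent_le {L s t : ℝ} (hs : s ∈ Set.Icc 0 L) (ht : t ∈ Set.Icc 0 L) :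
    |tent L s t| ≤ L := by
  wlog hst : s ≤ t generalizing s t
  · rw [tent_comm]; exact this ht hs (not_le.1 hst).le
  rw [tent_of_le hst, abs_of_nonneg (div_nonneg (mul_nonneg hs.1 (by linarith [ht.2]))
    (hs.1.trans hs.2))]
  refine div_le_of_le_mul₀ (hs.1.trans hs.2) (hs.1.trans hs.2) ?_
  exact mul_le_mul hs.2 (by linarith [ht.1]) (by linarith [ht.2]) (hs.1.trans hs.2)

theorem abs_kernel_le [Fintype V] [Fintype E] (M : V → V → ℝ) :
    ∃ C, ∀ x y, |G.kernel M x y| ≤ C := by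
  have hM : ∀ u v, |M u v| ≤ ∑ u, ∑ v, |M u v| := fun u v =>
    (Finset.single_le_sum (f := fun v => |M u v|) (fun _ _ => abs_nonneg _)
      (Finset.mem_univ v)).trans (Finset.single_le_sum (f := fun u => ∑ v, |M u v|)
      (fun _ _ => Finset.sum_nonneg fun _ _ => abs_nonneg _) (Finset.mem_univ u))
  have hlen : ∀ e, G.len e ≤ ∑ e, G.len e := fun e =>
    Finset.single_le_sum (f := G.len) (fun e _ => (G.len_pos e).le) (Finset.mem_univ e)
  have hlen0 : 0 ≤ ∑ e, G.len e := Finset.sum_nonneg fun e _ => (G.len_pos e).le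
  refine ⟨∑ u, ∑ v, |M u v| + ∑ e, G.len e, fun x y => ?_⟩
  have h1 : ∀ u, |interp (M u) y| ≤ ∑ u, ∑ v, |M u v| := fun u => abs_interp_le (hM u) y
  rcases x with u | ⟨e, s, hs⟩
  · exact (h1 u).trans (by linarith)
  · refine (abs_add_le _ _).trans (add_le_add
      (abs_interp_le (f := fun u => interp (M u) y) h1 (.inner e s hs)) ?_)
    rcases y with v | ⟨e', t, ht⟩
    · simpa [bump] using hlen0
    · simp only [bump]
      split_ifs with h
      · subst h
        exact (abs_tent_le ⟨hs.1.le, hs.2.le⟩ ⟨ht.1.le, ht.2.le⟩).trans (hlen e')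
      · simpa using hlen0

/-- A bounded continuous function is integrable. -/
theorem integrable_of_continuous_bounded {X : Type*} [TopologicalSpace X] [MeasurableSpace X]
    [OpensMeasurableSpace X] (μ : Measure X) [IsFiniteMeasure μ] {f : X → ℝ} {C : ℝ}
    (hf : Continuous f) (hC : ∀ x, |f x| ≤ C) : Integrable f μ :=
  Integrable.of_bound hf.aestronglyMeasurable C (Filter.Eventually.of_forall hC)

/-- The potential of a measure with respect to the grounded kernel. -/
noncomputable def potential (G : WeightedGraph V E) (M : V → V → ℝ) (μ : Measure G.Point)
    (x : G.Point) : ℝ := ∫ ζ, G.kernel M x ζ ∂μ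

section Potential

variable [Fintype E] {o : V} {M : V → V → ℝ}

theorem continuous_kernel_right (hM : G.IsGreenKernel o M) (x : G.Point) :
    Continuous fun y => G.kernel M x y := by
  simp only [kernel_comm hM.symm x]
  exact continuous_kernel_left M x

theorem potential_ground (hM : G.IsGreenKernel o M) (μ : Measure G.Point) :
    G.potential M μ (.vertex o) = 0 := by
  have : ∀ y, G.kernel M (.vertex o) y = 0 := by
    rintro (v | ⟨e, t, ht⟩) <;> simp [kernel, interp, hM.zero_left]
  simp [potential, this]

variable [Fintype V]

theorem integrable_kernel (hM : G.IsGreenKernel o M) (μ : Measure G.Point)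
    [IsFiniteMeasure μ] (x : G.Point) :
    Integrable (fun ζ => G.kernel M x ζ) μ := by
  obtain ⟨C, hC⟩ := abs_kernel_le (G := G) M
  exact integrable_of_continuous_bounded μ (continuous_kernel_right hM x) fun y => hC x y

theorem integrable_kernel_self (hM : G.IsGreenKernel o M) (μ : Measure G.Point)
    [IsFiniteMeasure μ] :
    Integrable (fun ζ => G.kernel M ζ ζ) μ := by
  obtain ⟨C, hC⟩ := abs_kernel_le (G := G) M
  exact integrable_of_continuous_bounded μ (continuous_kernel_self hM) fun y => hC y y

theorem continuous_potential (hM : G.IsGreenKernel o M) (μ : Measure G.Point)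
    [IsFiniteMeasure μ] : Continuous (G.potential M μ) := by
  obtain ⟨C, hC⟩ := abs_kernel_le (G := G) M
  refine continuous_point_iff.2 fun e => ?_
  refine continuous_of_dominated (bound := fun _ => C)
    (fun t => (continuous_kernel_right hM _).aestronglyMeasurable)
    (fun t => Filter.Eventually.of_forall fun y => hC _ y) (integrable_const C)
    (Filter.Eventually.of_forall fun y => (continuous_kernel_left M y).comp (continuous_param e))

theorem abs_potential_le (M : V → V → ℝ) (μ : Measure G.Point)
    [IsProbabilityMeasure μ] : ∃ C, ∀ x, |G.potential M μ x| ≤ C := by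
  obtain ⟨C, hC⟩ := abs_kernel_le (G := G) M
  refine ⟨C, fun x => ?_⟩
  have := norm_integral_le_of_norm_le_const (μ := μ) (f := fun ζ => G.kernel M x ζ)
    (C := C) (Filter.Eventually.of_forall fun y => hC x y)
  simpa [potential] using this

theorem integrable_potential (hM : G.IsGreenKernel o M) (μ : Measure G.Point)
    [IsProbabilityMeasure μ] : Integrable (G.potential M μ) μ := by
  obtain ⟨C, hC⟩ := abs_potential_le M μ
  exact integrable_of_continuous_bounded μ (continuous_potential hM μ) hC

theorem green_eq (hG : G.Connected) (hM : G.IsGreenKernel o M) (μ : Measure G.Point)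
    [IsProbabilityMeasure μ] (x y : G.Point) :
    G.green μ x y = G.kernel M x y - G.potential M μ x - G.potential M μ y +
      ∫ ξ, G.potential M μ ξ ∂μ := by
  have hy : Integrable (fun ζ => G.kernel M ζ y) μ := by
    simpa only [kernel_comm hM.symm y] using integrable_kernel hM μ y
  have hswap : ∫ ζ, G.kernel M ζ y ∂μ = G.potential M μ y := by
    simp only [kernel_comm hM.symm _ y, potential]
  have h1 : ∀ x, ∫ ζ, G.j ζ x y ∂μ = (G.kernel M x y - G.potential M μ x) -
      (G.potential M μ y - ∫ ζ, G.kernel M ζ ζ ∂μ) := fun x => by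
    simp only [j_eq_kernel hG hM]
    have i1 : Integrable (fun ζ => G.kernel M x y - G.kernel M x ζ) μ :=
      (integrable_const _).sub (integrable_kernel hM μ x)
    have i2 : Integrable (fun ζ => G.kernel M ζ y - G.kernel M ζ ζ) μ :=
      hy.sub (integrable_kernel_self hM μ)
    rw [integral_sub i1 i2, integral_sub (integrable_const _) (integrable_kernel hM μ x),
      integral_sub hy (integrable_kernel_self hM μ), integral_const, hswap]
    simp only [potential, probReal_univ, one_smul]
  rw [green]
  simp only [h1]
  have i3 : Integrable (fun ξ => G.kernel M ξ y - G.potential M μ ξ) μ :=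
    hy.sub (integrable_potential hM μ)
  rw [integral_sub i3 (integrable_const _), integral_sub hy (integrable_potential hM μ),
    integral_const, hswap, probReal_univ, one_smul]
  ring

end Potential

end WeightedGraph

/-! ### The admissible measure -/

namespace WeightedGraph

variable {V E : Type*} {G : WeightedGraph V E}

theorem integral_bump_vertex (e : E) (v : V) :
    ∫ s in (0 : ℝ)..G.len e, G.bump e s (.vertex v) = 0 := by
  simp [bump]

open Classical in
theorem integral_bump_inner (e e' : E) (t : ℝ) (ht : t ∈ Set.Ioo 0 (G.len e')) :
    ∫ s in (0 : ℝ)..G.len e, G.bump e s (.inner e' t ht) =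
      if e' = e then t * (G.len e' - t) / 2 else 0 := by
  by_cases h : e' = e
  · subst h
    have hL := (G.len_pos e').ne'
    simp only [bump, if_true]
    have hc : Continuous fun s => tent (G.len e') s t := by unfold tent; fun_prop
    rw [← intervalIntegral.integral_add_adjacent_intervals (b := t)
      (hc.intervalIntegrable _ _) (hc.intervalIntegrable _ _)]
    have h1 : ∫ s in (0 : ℝ)..t, tent (G.len e') s t =
        ∫ s in (0 : ℝ)..t, s * ((G.len e' - t) / G.len e') := by
      refine intervalIntegral.integral_congr fun s hs => ?_
      rw [Set.uIcc_of_le ht.1.le] at hs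
      simp only [tent_of_le hs.2]; ring
    have h2 : ∫ s in t..G.len e', tent (G.len e') s t =
        ∫ s in t..G.len e', (t - s * (t / G.len e')) := by
      refine intervalIntegral.integral_congr fun s hs => ?_
      rw [Set.uIcc_of_le ht.2.le] at hs
      simp only [tent_comm _ s t, tent_of_le hs.1]; field_simp
    rw [h1, h2, intervalIntegral.integral_mul_const, integral_id,
      intervalIntegral.integral_sub (by simp) (Continuous.intervalIntegrable (by fun_prop) _ _),
      intervalIntegral.integral_mul_const, integral_id, intervalIntegral.integral_const,
      smul_eq_mul]
    field_simp
    ring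
  · simp [bump, h]

theorem integral_affine (L A B : ℝ) (hL : L ≠ 0) :
    ∫ s in (0 : ℝ)..L, ((1 - s / L) * A + s / L * B) = L / 2 * (A + B) := by
  have h1 : (fun s => (1 - s / L) * A + s / L * B) = fun s => A + s * ((B - A) / L) := by
    funext s; ring
  rw [h1, intervalIntegral.integral_add (by simp) (Continuous.intervalIntegrable (by fun_prop) _ _),
    intervalIntegral.integral_mul_const, integral_id, intervalIntegral.integral_const, smul_eq_mul]
  field_simp
  ring

theorem integral_mul_sub (L : ℝ) : ∫ s in (0 : ℝ)..L, s * (L - s) = L ^ 3 / 6 := by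
  have h1 : (fun s => s * (L - s)) = fun s => s * L - s ^ 2 := by funext s; ring
  rw [h1, intervalIntegral.integral_sub (Continuous.intervalIntegrable (by fun_prop) _ _)
    (Continuous.intervalIntegrable (by fun_prop) _ _),
    intervalIntegral.integral_mul_const, integral_id, integral_pow]
  norm_num
  ring

theorem intervalIntegral_kernel (M : V → V → ℝ) (e : E) (y : G.Point) :
    ∫ s in (0 : ℝ)..G.len e, G.kernel M (G.param e s) y =
      G.len e / 2 * (interp (M (G.tail e)) y + interp (M (G.head e)) y) +
        ∫ s in (0 : ℝ)..G.len e, G.bump e s y := by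
  rw [← integral_affine _ _ _ (G.len_pos e).ne', ← intervalIntegral.integral_add
    (Continuous.intervalIntegrable (by fun_prop) _ _)
    ((continuous_bump e y).intervalIntegrable _ _)]
  refine intervalIntegral.integral_congr fun s hs => ?_
  rw [Set.uIcc_of_le (G.len_pos e).le] at hs
  exact kernel_param M hs y

theorem intervalIntegral_kernel_self [Fintype E] {o : V} {M : V → V → ℝ}
    (hM : G.IsGreenKernel o M) (e : E) :
    ∫ s in (0 : ℝ)..G.len e, G.kernel M (G.param e s) (G.param e s) =
      G.len e / 2 * (M (G.tail e) (G.tail e) + M (G.head e) (G.head e)) +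
        G.foster M e * G.len e ^ 2 / 6 := by
  have hL := (G.len_pos e).ne'
  have h : G.foster M e * G.len e ^ 2 / 6 =
      ∫ s in (0 : ℝ)..G.len e, G.foster M e / G.len e * (s * (G.len e - s)) := by
    rw [intervalIntegral.integral_const_mul, integral_mul_sub]
    field_simp
  rw [h, ← integral_affine _ _ _ hL, ← intervalIntegral.integral_add
    (Continuous.intervalIntegrable (by fun_prop) _ _)
    (Continuous.intervalIntegrable (by fun_prop) _ _)]
  refine intervalIntegral.integral_congr fun s hs => ?_
  rw [Set.uIcc_of_le (G.len_pos e).le] at hs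
  exact kernel_param_self hM hs

/-- The discrete canonical measure represents the diagonal of the kernel, up to a correction on
the edges. -/
theorem canon_interp [Fintype V] [Fintype E] {o : V} {M : V → V → ℝ}
    (hM : G.IsGreenKernel o M) (y : G.Point) :
    G.canon M (fun v => interp (M v) y) = interp (fun v => M v v) y := by
  rcases y with v | ⟨e, t, ht⟩
  · exact hM.canon_green v
  · simp only [interp]
    rw [canon_add (fun v => (1 - t / G.len e) * M v (G.tail e)) fun v =>
      t / G.len e * M v (G.head e), canon_mul, canon_mul, hM.canon_green, hM.canon_green]

/-- Fubini's theorem for the kernel on an edge. -/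
theorem integral_intervalIntegral_kernel [Fintype V] [Fintype E] {o : V} {M : V → V → ℝ}
    (hM : G.IsGreenKernel o M) (μ : Measure G.Point) [IsProbabilityMeasure μ] (e : E) :
    Integrable (fun y => ∫ s in (0 : ℝ)..G.len e, G.kernel M (G.param e s) y) μ ∧
    ∫ y, (∫ s in (0 : ℝ)..G.len e, G.kernel M (G.param e s) y) ∂μ =
      ∫ s in (0 : ℝ)..G.len e, G.potential M μ (G.param e s) := by
  obtain ⟨C, hC⟩ := abs_kernel_le (G := G) M
  have hmeas : Measurable (Function.uncurry fun s y => G.kernel M (G.param e s) y) :=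
    measurable_uncurry_of_continuous_of_measurable
      (fun y => (continuous_kernel_left M y).comp (continuous_param e))
      (fun s => (continuous_kernel_right hM _).measurable)
  have hint : Integrable (Function.uncurry fun s y => G.kernel M (G.param e s) y)
      ((volume.restrict (Set.Ioc 0 (G.len e))).prod μ) :=
    Integrable.of_bound hmeas.aestronglyMeasurable C
      (Filter.Eventually.of_forall fun p => hC _ _)
  simp only [intervalIntegral.integral_of_le (G.len_pos e).le]
  exact ⟨hint.integral_prod_right, (integral_integral_swap hint).symm⟩

theorem sum_valency_mul [Fintype V] [Fintype E] (f : V → ℝ) :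
    ∑ v, (G.valency v : ℝ) * f v = ∑ e, (f (G.tail e) + f (G.head e)) := by
  classical
  have h1 := sum_ite_mul_endpoint f (fun _ _ => 1) G.tail
  have h2 := sum_ite_mul_endpoint f (fun _ _ => 1) G.head
  simp only [mul_one] at h1 h2
  rw [Finset.sum_add_distrib, h1, h2, ← Finset.sum_add_distrib]
  refine Finset.sum_congr rfl fun v _ => ?_
  simp only [valency, Nat.cast_add, Finset.card_filter, Nat.cast_sum, Nat.cast_ite,
    Nat.cast_one, Nat.cast_zero]
  rw [← mul_add, mul_comm]

end WeightedGraph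

namespace PolarizedGraph

theorem K_nonneg {V E : Type*} [Fintype E] (G : PolarizedGraph V E) (v : V) : 0 ≤ G.K v := by
  have := G.polarized v
  rw [K]; omega

variable {V E : Type*} [Fintype V] [Fintype E] {G : PolarizedGraph V E}

theorem sum_K_mul (f : V → ℝ) :
    ∑ v, (G.K v : ℝ) * f v =
      ∑ e, (f (G.tail e) + f (G.head e)) - 2 * ∑ v, f v + 2 * ∑ v, (G.q v : ℝ) * f v := by
  rw [← WeightedGraph.sum_valency_mul, Finset.mul_sum, Finset.mul_sum, ← Finset.sum_sub_distrib,
    ← Finset.sum_add_distrib]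
  refine Finset.sum_congr rfl fun v _ => ?_
  rw [K]; push_cast; ring

/-- The degree of the canonical divisor. -/
theorem sum_K : ∑ v, (G.K v : ℝ) = 2 * G.genus - 2 := by
  have h := sum_K_mul (G := G) fun _ => 1
  simp only [mul_one, Finset.sum_const, Finset.card_univ, nsmul_eq_mul] at h
  rw [h, genus]; push_cast; ring

/-- The identity `δ_K + 2 w = 2 q + ∑ e, F e (δ_tail + δ_head)` between measures on the vertices,
where `w` is the discrete canonical measure. -/
theorem sum_K_mul_add_canon (M : V → V → ℝ) (f : V → ℝ) :
    ∑ v, (G.K v : ℝ) * f v + G.canon M f = 2 * ∑ v, (G.q v : ℝ) * f v +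
      ∑ e, G.foster M e * (f (G.tail e) + f (G.head e)) := by
  rw [sum_K_mul, WeightedGraph.canon]
  simp only [mul_sub, mul_one, Finset.sum_sub_distrib, mul_comm (G.foster M _)]
  ring

/-- The admissible measure, given by the formula
`μ = (1 / g) (∑ v, q v δ_v + ∑ e, (F e / len e) dx)`. -/
noncomputable def admissible (G : PolarizedGraph V E) (M : V → V → ℝ) : Measure G.Point :=
  ∑ v, ENNReal.ofReal (G.q v / G.genus) • Measure.dirac (.vertex v) +
    ∑ e, ENNReal.ofReal (G.foster M e / (G.genus * G.len e)) •
      (volume.restrict (Set.Icc 0 (G.len e))).map (G.param e)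

section Admissible

variable {o : V} {M : V → V → ℝ}

theorem integral_admissible (hM : G.IsGreenKernel o M) (hg : 0 < G.genus) {f : G.Point → ℝ} {C : ℝ}
    (hf : Continuous f) (hC : ∀ x, |f x| ≤ C) :
    G.genus * ∫ x, f x ∂(G.admissible M) = ∑ v, (G.q v : ℝ) * f (.vertex v) +
      ∑ e, G.foster M e / G.len e * ∫ s in (0 : ℝ)..G.len e, f (G.param e s) := by
  have hg' : (0 : ℝ) < G.genus := by exact_mod_cast hg
  have hmeas := fun e => (WeightedGraph.continuous_param (G := G.toWeightedGraph) e).measurable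
  have i1 : ∀ v, Integrable f
      (ENNReal.ofReal (G.q v / G.genus) • Measure.dirac (.vertex v : G.Point)) := fun v =>
    (WeightedGraph.integrable_of_continuous_bounded _ hf hC).smul_measure ENNReal.ofReal_ne_top
  have i2 : ∀ e, Integrable f (ENNReal.ofReal (G.foster M e / (G.genus * G.len e)) •
      (volume.restrict (Set.Icc 0 (G.len e))).map (G.param e)) := fun e =>
    (WeightedGraph.integrable_of_continuous_bounded _ hf hC).smul_measure ENNReal.ofReal_ne_top
  rw [admissible, integral_add_measure (integrable_finsetSum_measure.2 fun v _ => i1 v)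
    (integrable_finsetSum_measure.2 fun e _ => i2 e),
    integral_finsetSum_measure fun v _ => i1 v, integral_finsetSum_measure fun e _ => i2 e,
    mul_add, Finset.mul_sum, Finset.mul_sum]
  congr 1 <;> refine Finset.sum_congr rfl fun x _ => ?_
  · rw [integral_smul_measure, integral_dirac' _ _ hf.stronglyMeasurable,
      ENNReal.toReal_ofReal (by positivity), smul_eq_mul]
    field_simp
  · have hL := G.len_pos x
    rw [integral_smul_measure, integral_map (hmeas x).aemeasurable hf.aestronglyMeasurable,
      ENNReal.toReal_ofReal (div_nonneg (hM.foster_nonneg x) (by positivity)), smul_eq_mul,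
      integral_Icc_eq_integral_Ioc, ← intervalIntegral.integral_of_le hL.le]
    field_simp

theorem isProbabilityMeasure_admissible (hM : G.IsGreenKernel o M) (hg : 0 < G.genus) :
    IsProbabilityMeasure (G.admissible M) := by
  have hg' : (0 : ℝ) < G.genus := by exact_mod_cast hg
  refine ⟨?_⟩
  have hmeas := fun e => (WeightedGraph.continuous_param (G := G.toWeightedGraph) e).measurable
  simp only [admissible, Measure.coe_add, Pi.add_apply, Measure.coe_finsetSum, Finset.sum_apply,
    Measure.smul_apply, smul_eq_mul, measure_univ, mul_one]
  have h1 : ∀ e, (Measure.map (G.param e) (volume.restrict (Set.Icc 0 (G.len e)))) Set.univ =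
      ENNReal.ofReal (G.len e) := fun e => by
    rw [Measure.map_apply (hmeas e) MeasurableSet.univ]; simp
  have h2 : ∀ e, ENNReal.ofReal (G.foster M e / (G.genus * G.len e)) * ENNReal.ofReal (G.len e) =
      ENNReal.ofReal (G.foster M e / G.genus) := fun e => by
    have hL := G.len_pos e
    rw [← ENNReal.ofReal_mul (div_nonneg (hM.foster_nonneg e) (by positivity))]
    congr 1
    field_simp
  simp only [h1, h2]
  rw [← ENNReal.ofReal_sum_of_nonneg fun v _ => by positivity,
    ← ENNReal.ofReal_sum_of_nonneg fun e _ => div_nonneg (hM.foster_nonneg e) hg'.le,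
    ← ENNReal.ofReal_add (Finset.sum_nonneg fun v _ => by positivity)
      (Finset.sum_nonneg fun e _ => div_nonneg (hM.foster_nonneg e) hg'.le),
    ← Finset.sum_div, ← Finset.sum_div, hM.sum_foster, ← add_div,
    show ∑ v, (G.q v : ℝ) + (Fintype.card E - Fintype.card V + 1) = G.genus by
      rw [genus]; push_cast; ring, div_self hg'.ne', ENNReal.ofReal_one]

/-- The potential of the admissible measure. -/
theorem potential_admissible (hM : G.IsGreenKernel o M) (hg : 0 < G.genus) (y : G.Point) :
    2 * G.genus * G.potential M (G.admissible M) y =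
      G.kernel M y y + ∑ v, (G.K v : ℝ) * G.kernel M (.vertex v) y := by
  classical
  obtain ⟨C, hC⟩ := WeightedGraph.abs_kernel_le (G := G.toWeightedGraph) M
  have h := integral_admissible hM hg (WeightedGraph.continuous_kernel_left M y) (hC · y)
  simp only [WeightedGraph.kernel_comm hM.symm _ y] at h
  rw [WeightedGraph.potential, mul_assoc, h]
  simp only [← WeightedGraph.kernel_comm hM.symm _ y, WeightedGraph.intervalIntegral_kernel,
    WeightedGraph.kernel_vertex_left]
  have h1 := sum_K_mul_add_canon (G := G) M fun v => WeightedGraph.interp (M v) y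
  rw [WeightedGraph.canon_interp hM] at h1
  have h2 : ∑ e, G.foster M e / G.len e * (G.len e / 2 * (WeightedGraph.interp (M (G.tail e)) y +
      WeightedGraph.interp (M (G.head e)) y) + ∫ s in (0 : ℝ)..G.len e, G.bump e s y) =
      (∑ e, G.foster M e * (WeightedGraph.interp (M (G.tail e)) y +
        WeightedGraph.interp (M (G.head e)) y)) / 2 +
      ∑ e, G.foster M e / G.len e * ∫ s in (0 : ℝ)..G.len e, G.bump e s y := by
    rw [Finset.sum_div, ← Finset.sum_add_distrib]
    refine Finset.sum_congr rfl fun e _ => ?_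
    have := (G.len_pos e).ne'
    field_simp
  have h3 : G.kernel M y y = WeightedGraph.interp (fun v => M v v) y +
      2 * ∑ e, G.foster M e / G.len e * ∫ s in (0 : ℝ)..G.len e, G.bump e s y := by
    rcases y with v | ⟨e, t, ht⟩
    · simp [WeightedGraph.integral_bump_vertex, WeightedGraph.kernel, WeightedGraph.interp]
    · rw [WeightedGraph.kernel_inner_self hM]
      simp only [WeightedGraph.integral_bump_inner, mul_ite, mul_zero, Finset.sum_ite_eq,
        Finset.mem_univ, if_true]
      ring
  rw [h2, h3]
  linarith

/-- A probability measure is admissible if and only if its potential is the explicit function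
`(k(x, x) + k(K, x)) / 2 g`. -/
theorem isAdmissible_iff (hG : G.Connected) (hM : G.IsGreenKernel o M) (μ : Measure G.Point) :
    G.IsAdmissible μ ↔ IsProbabilityMeasure μ ∧ ∀ x, 2 * G.genus * G.potential M μ x =
      G.kernel M x x + ∑ v, (G.K v : ℝ) * G.kernel M (.vertex v) x := by
  refine and_congr_right fun hμ => ?_
  have key : ∀ x, G.green μ x x + ∑ v, (G.K v : ℝ) * G.green μ (.vertex v) x =
      G.kernel M x x + ∑ v, (G.K v : ℝ) * G.kernel M (.vertex v) x -
      2 * G.genus * G.potential M μ x + ((2 * G.genus - 1) * (∫ ξ, G.potential M μ ξ ∂μ) -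
        ∑ v, (G.K v : ℝ) * G.potential M μ (.vertex v)) := fun x => by
    simp only [WeightedGraph.green_eq hG hM μ, mul_add, mul_sub, Finset.sum_add_distrib,
      Finset.sum_sub_distrib, ← Finset.sum_mul, sum_K]
    ring
  simp only [key]
  constructor
  · rintro ⟨c, hc⟩ x
    have h0 : ∀ v, G.kernel M (.vertex v) (.vertex o) = 0 := fun v => by
      rw [WeightedGraph.kernel_vertex_left]; exact hM.zero_right v
    have ho := hc (.vertex o)
    rw [WeightedGraph.potential_ground hM] at ho
    simp only [h0, mul_zero, Finset.sum_const_zero] at ho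
    have hx := hc x
    linarith
  · intro h
    exact ⟨_, fun x => by rw [h x, sub_self]⟩

theorem isAdmissible_admissible (hG : G.Connected) (hM : G.IsGreenKernel o M)
    (hg : 0 < G.genus) : G.IsAdmissible (G.admissible M) :=
  (isAdmissible_iff hG hM _).2
    ⟨isProbabilityMeasure_admissible hM hg, potential_admissible hM hg⟩

/-- The mutual energy of a probability measure `μ` and the explicit admissible measure is symmetric.
Consequently, if `μ` has the same potential as the latter, then it has the same energy. -/
theorem integral_potential_eq (hM : G.IsGreenKernel o M) (hg : 0 < G.genus) (μ : Measure G.Point)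
    [IsProbabilityMeasure μ] :
    ∫ x, G.potential M (G.admissible M) x ∂μ = ∫ x, G.potential M μ x ∂(G.admissible M) := by
  have hg' : (0 : ℝ) < G.genus := by exact_mod_cast hg
  obtain ⟨C, hC⟩ := WeightedGraph.abs_kernel_le (G := G.toWeightedGraph) M
  obtain ⟨C', hC'⟩ := WeightedGraph.abs_potential_le (G := G.toWeightedGraph) M μ
  refine mul_left_cancel₀ hg'.ne' ?_
  rw [integral_admissible hM hg (WeightedGraph.continuous_potential hM μ) hC',
    ← integral_const_mul]
  have h1 : ∀ y, G.genus * G.potential M (G.admissible M) y =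
      ∑ v, (G.q v : ℝ) * G.kernel M (.vertex v) y +
      ∑ e, G.foster M e / G.len e * ∫ s in (0 : ℝ)..G.len e, G.kernel M (G.param e s) y := by
    intro y
    rw [← integral_admissible hM hg (WeightedGraph.continuous_kernel_left M y) (hC · y)]
    simp only [WeightedGraph.potential, WeightedGraph.kernel_comm hM.symm _ y]
  simp only [h1]
  have i1 : ∀ v, Integrable (fun y => (G.q v : ℝ) * G.kernel M (.vertex v) y) μ := fun v =>
    (WeightedGraph.integrable_kernel hM μ _).const_mul _
  have i2 : ∀ e, Integrable (fun y => G.foster M e / G.len e *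
      ∫ s in (0 : ℝ)..G.len e, G.kernel M (G.param e s) y) μ := fun e =>
    (WeightedGraph.integral_intervalIntegral_kernel hM μ e).1.const_mul _
  rw [integral_add (integrable_finsetSum _ fun v _ => i1 v)
    (integrable_finsetSum _ fun e _ => i2 e), integral_finsetSum _ fun v _ => i1 v,
    integral_finsetSum _ fun e _ => i2 e]
  simp only [integral_const_mul, (WeightedGraph.integral_intervalIntegral_kernel hM μ _).2]
  rfl

end Admissible

end PolarizedGraph

/-! ### The slope formula -/

namespace PolarizedGraph

theorem delta0_of_bridgeless {V E : Type*} [Fintype E] {G : PolarizedGraph V E}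
    (hb : G.Bridgeless) : G.delta0 = G.totalLength :=
  Finset.sum_congr rfl fun e _ => if_neg (hb e)

variable {V E : Type*} [Fintype V] [Fintype E] {G : PolarizedGraph V E}

/-- The potential `k(K, ·)` of the canonical divisor on the vertices. -/
noncomputable def canonicalPotential (G : PolarizedGraph V E) (M : V → V → ℝ) (v : V) : ℝ :=
  ∑ u, (G.K u : ℝ) * M u v

theorem canon_canonicalPotential {o : V} {M : V → V → ℝ} (hM : G.IsGreenKernel o M) :
    G.canon M (G.canonicalPotential M) = ∑ v, (G.K v : ℝ) * M v v := by
  have h1 : ∀ s : Finset V, G.canon M (fun v => ∑ u ∈ s, (G.K u : ℝ) * M u v) =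
      ∑ u ∈ s, (G.K u : ℝ) * M u u := by
    classical
    intro s
    induction s using Finset.induction_on with
    | empty => simp [WeightedGraph.canon]
    | insert u s hu ih =>
      simp only [Finset.sum_insert hu]
      rw [WeightedGraph.canon_add (fun v => (G.K u : ℝ) * M u v) fun v =>
        ∑ u ∈ s, (G.K u : ℝ) * M u v, ih, WeightedGraph.canon_mul]
      have h : G.canon M (fun v => M u v) = M u u :=
        (congrArg _ (funext (hM.symm u))).trans (hM.canon_green u)
      rw [h]
  exact h1 Finset.univ

/-- The energy of an admissible measure. -/
theorem energy_of_isAdmissible (hG : G.Connected) {o : V} {M : V → V → ℝ}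
    (hM : G.IsGreenKernel o M) (hg : 0 < G.genus) {μ : Measure G.Point} (hμ : G.IsAdmissible μ) :
    4 * (G.genus : ℝ) ^ 2 * ∫ x, G.potential M μ x ∂μ =
      2 * ∑ v, (G.K v : ℝ) * M v v + ∑ v, (G.K v : ℝ) * G.canonicalPotential M v +
      G.canon M (fun v => M v v) + (∑ e, G.foster M e ^ 2 * G.len e) / 3 := by
  have hg' : (0 : ℝ) < G.genus := by exact_mod_cast hg
  obtain ⟨hprob, hpot⟩ := (isAdmissible_iff hG hM μ).1 hμ
  have hpot_eq : ∀ x, G.potential M μ x = G.potential M (G.admissible M) x := fun x =>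
    mul_left_cancel₀ (mul_pos two_pos hg').ne' ((hpot x).trans (potential_admissible hM hg x).symm)
  obtain ⟨C', hC'⟩ := WeightedGraph.abs_potential_le (G := G.toWeightedGraph) M μ
  have hI : ∫ x, G.potential M μ x ∂μ = ∫ x, G.potential M μ x ∂(G.admissible M) := by
    rw [← integral_potential_eq hM hg μ]
    exact integral_congr_ae (Filter.Eventually.of_forall hpot_eq)
  have h1 := integral_admissible hM hg (WeightedGraph.continuous_potential hM μ) hC'
  rw [← hI] at h1
  set N : V → ℝ := fun v => M v v + G.canonicalPotential M v with hN
  have hv : ∀ v, 2 * (G.genus : ℝ) * G.potential M μ (.vertex v) = N v := fun v => by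
    rw [hpot]; rfl
  have he : ∀ e, 2 * (G.genus : ℝ) * ∫ s in (0 : ℝ)..G.len e, G.potential M μ (G.param e s) =
      G.len e / 2 * (N (G.tail e) + N (G.head e)) + G.foster M e * G.len e ^ 2 / 6 := fun e => by
    rw [← intervalIntegral.integral_const_mul]
    simp only [hpot]
    have hc : ∀ v, Continuous fun s => G.kernel M (.vertex v) (G.param e s) := fun v =>
      (WeightedGraph.continuous_kernel_right hM (.vertex v)).comp (WeightedGraph.continuous_param e)
    have hc' : Continuous fun s => G.kernel M (G.param e s) (G.param e s) :=
      (WeightedGraph.continuous_kernel_self hM).comp (WeightedGraph.continuous_param e)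
    have hv : ∀ v, ∫ s in (0 : ℝ)..G.len e, G.kernel M (.vertex v) (G.param e s) =
        G.len e / 2 * (M v (G.tail e) + M v (G.head e)) := fun v => by
      simp only [WeightedGraph.kernel_comm hM.symm (.vertex v)]
      rw [WeightedGraph.intervalIntegral_kernel, WeightedGraph.integral_bump_vertex, add_zero,
        hM.symm v, hM.symm v]
      rfl
    rw [intervalIntegral.integral_add (hc'.intervalIntegrable _ _)
      (Continuous.intervalIntegrable (by fun_prop) _ _),
      WeightedGraph.intervalIntegral_kernel_self hM, intervalIntegral.integral_finsetSum
        fun v _ => Continuous.intervalIntegrable (by fun_prop) _ _]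
    simp only [intervalIntegral.integral_const_mul, hv, hN, canonicalPotential]
    have : ∑ v, (G.K v : ℝ) * (G.len e / 2 * (M v (G.tail e) + M v (G.head e))) =
        G.len e / 2 * (∑ v, (G.K v : ℝ) * M v (G.tail e) + ∑ v, (G.K v : ℝ) * M v (G.head e)) := by
      rw [← Finset.sum_add_distrib, Finset.mul_sum]
      exact Finset.sum_congr rfl fun v _ => by ring
    rw [this]
    ring
  have h2 : 4 * (G.genus : ℝ) ^ 2 * ∫ x, G.potential M μ x ∂μ =
      2 * ∑ v, (G.q v : ℝ) * N v + ∑ e, G.foster M e * (N (G.tail e) + N (G.head e)) +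
        (∑ e, G.foster M e ^ 2 * G.len e) / 3 := by
    have h3 : 4 * (G.genus : ℝ) ^ 2 * ∫ x, G.potential M μ x ∂μ =
        2 * (∑ v, (G.q v : ℝ) * (2 * (G.genus : ℝ) * G.potential M μ (.vertex v)) +
        ∑ e, G.foster M e / G.len e *
          (2 * (G.genus : ℝ) * ∫ s in (0 : ℝ)..G.len e, G.potential M μ (G.param e s))) := by
      rw [show 4 * (G.genus : ℝ) ^ 2 * ∫ x, G.potential M μ x ∂μ =
        4 * G.genus * (G.genus * ∫ x, G.potential M μ x ∂μ) by ring, h1]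
      simp only [mul_left_comm _ (2 * (G.genus : ℝ)), ← Finset.mul_sum]
      ring
    rw [h3]
    simp only [hv, he]
    rw [mul_add, add_assoc, Finset.sum_div, ← Finset.sum_add_distrib]
    congr 1
    rw [Finset.mul_sum]
    refine Finset.sum_congr rfl fun e _ => ?_
    have := (G.len_pos e).ne'
    field_simp
    ring
  rw [h2, ← sum_K_mul_add_canon, hN, WeightedGraph.canon_add (fun v => M v v),
    canon_canonicalPotential hM]
  simp only [mul_add, Finset.sum_add_distrib]
  ring

theorem delta_of_bridgeless (hb : G.Bridgeless) (h : ℤ) : G.delta h = 0 :=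
  Finset.sum_eq_zero fun e _ => if_neg fun he => hb e he.1

/-- The slope in terms of a Green kernel on the vertices. -/
theorem slope_eq (hG : G.Connected) (hb : G.Bridgeless) {o : V} {M : V → V → ℝ}
    (hM : G.IsGreenKernel o M) (hg : 0 < G.genus) :
    G.slope = 2 * (G.genus - 1) * ∑ v, (G.K v : ℝ) * M v v -
      ∑ v, (G.K v : ℝ) * G.canonicalPotential M v +
      3 / 2 * (G.genus - 1) * G.canon M (fun v => M v v) -
      (G.genus - 1) / 2 * ∑ e, G.len e * (1 - G.foster M e ^ 2) := by
  have hg' : (0 : ℝ) < G.genus := by exact_mod_cast hg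
  have hμ : G.IsAdmissible G.admissibleMeasure :=
    Classical.epsilon_spec ⟨_, isAdmissible_admissible hG hM hg⟩
  obtain ⟨hprob, hpot⟩ := (isAdmissible_iff hG hM _).1 hμ
  have henergy := energy_of_isAdmissible hG hM hg hμ
  set μ := G.admissibleMeasure with hμdef
  set I := ∫ x, G.potential M μ x ∂μ with hI
  set p : V → ℝ := fun v => G.potential M μ (.vertex v) with hp
  have hp1 : 2 * (G.genus : ℝ) * ∑ v, (G.K v : ℝ) * p v =
      ∑ v, (G.K v : ℝ) * M v v + ∑ v, (G.K v : ℝ) * G.canonicalPotential M v := by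
    rw [← Finset.sum_add_distrib, Finset.mul_sum]
    refine Finset.sum_congr rfl fun v _ => ?_
    rw [mul_left_comm, hp, hpot, ← mul_add]
    rfl
  have hdiag : ∀ x, G.greenDiag x = G.kernel M x x - 2 * G.potential M μ x + I := fun x => by
    rw [greenDiag, WeightedGraph.green_eq hG hM]; ring
  have hKdiag : ∑ v, (G.K v : ℝ) * G.greenDiag (.vertex v) =
      ∑ v, (G.K v : ℝ) * M v v - 2 * ∑ v, (G.K v : ℝ) * p v + (2 * G.genus - 2) * I := by
    have h1 : ∀ v, (G.K v : ℝ) * G.greenDiag (.vertex v) =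
        (G.K v : ℝ) * M v v - 2 * ((G.K v : ℝ) * p v) + (G.K v : ℝ) * I := fun v => by
      rw [hdiag]
      change (G.K v : ℝ) * (M v v - 2 * p v + I) = _
      ring
    simp only [h1, Finset.sum_add_distrib, Finset.sum_sub_distrib, ← Finset.mul_sum,
      ← Finset.sum_mul, sum_K]
  have hself : ∫ x, G.kernel M x x ∂μ = 2 * G.genus * I - ∑ v, (G.K v : ℝ) * p v := by
    have i1 : ∀ v, Integrable (fun x => (G.K v : ℝ) * G.kernel M (.vertex v) x) μ := fun v =>
      (WeightedGraph.integrable_kernel hM μ _).const_mul _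
    have h1 : ∀ x, G.kernel M x x = 2 * (G.genus : ℝ) * G.potential M μ x -
        ∑ v, (G.K v : ℝ) * G.kernel M (.vertex v) x := fun x => by rw [hpot]; ring
    simp only [h1]
    rw [integral_sub ((WeightedGraph.integrable_potential hM μ).const_mul _)
      (integrable_finsetSum _ fun v _ => i1 v), integral_const_mul,
      integral_finsetSum _ fun v _ => i1 v]
    simp only [integral_const_mul]
    rfl
  have hint : ∫ x, G.greenDiag x ∂μ = (2 * G.genus - 1) * I - ∑ v, (G.K v : ℝ) * p v := by
    simp only [hdiag]
    have i1 : Integrable (fun x => G.kernel M x x - 2 * G.potential M μ x) μ :=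
      (WeightedGraph.integrable_kernel_self hM μ).sub
        ((WeightedGraph.integrable_potential hM μ).const_mul _)
    rw [integral_add i1 (integrable_const _),
      integral_sub (WeightedGraph.integrable_kernel_self hM μ)
        ((WeightedGraph.integrable_potential hM μ).const_mul _), integral_const_mul, hself,
      integral_const, probReal_univ, one_smul]
    ring
  have hlen : ∑ e, G.len e * (1 - G.foster M e ^ 2) =
      G.totalLength - ∑ e, G.foster M e ^ 2 * G.len e := by
    rw [totalLength, ← Finset.sum_sub_distrib]
    exact Finset.sum_congr rfl fun e _ => by ring
  simp only [slope, lam, phi, epsilon, delta_of_bridgeless hb, delta0_of_bridgeless hb, mul_zero,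
    Finset.sum_const_zero, sub_zero]
  rw [← hμdef, hint, hKdiag, hlen]
  have hscale : ∀ x y : ℝ, (8 * (G.genus : ℝ) + 4) * ((G.genus - 1) / (6 * (2 * G.genus + 1)) * x +
      1 / 12 * y) = 2 / 3 * (G.genus - 1) * x + (2 * G.genus + 1) / 3 * y := fun x y => by
    have hg2 : 2 * (G.genus : ℝ) + 1 ≠ 0 := by positivity
    field_simp
    ring
  rw [hscale]
  linear_combination (3 / 2 * ((G.genus : ℝ) - 1)) * henergy - ((3 * (G.genus : ℝ) - 1) / 2) * hp1

/-- The slope of a bridgeless polarized graph as a sum of local terms. -/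
theorem slope_eq_sum (hG : G.Connected) (hb : G.Bridgeless) {o : V} {M : V → V → ℝ}
    (hM : G.IsGreenKernel o M) (hg : 0 < G.genus) :
    G.slope = ∑ y, (G.K y : ℝ) * (∑ p, (G.q p : ℝ) * (M p p - M p y - M y p + M y y) +
      ∑ e, G.excess (fun x z => M x z - M x y - M y z + M y y) e) := by
  have h1 : ∀ y, ∑ p, (G.q p : ℝ) * (M p p - M p y - M y p + M y y) +
      ∑ e, G.excess (fun x z => M x z - M x y - M y z + M y y) e =
      3 / 4 * G.canon M (fun v => M v v) + 1 / 2 * (∑ v, (G.K v : ℝ) * M v v +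
        (2 * G.genus - 2) * M y y - 2 * G.canonicalPotential M y) -
      1 / 4 * ∑ e, G.len e * (1 - G.foster M e ^ 2) := by
    intro y
    set r : V → ℝ := fun x => M x x + M y y - 2 * M x y with hr
    have h2 : 4 * ∑ e, G.excess (fun x z => M x z - M x y - M y z + M y y) e =
        G.energy r r + 2 * ∑ e, G.foster M e * (r (G.tail e) + r (G.head e)) -
        ∑ e, G.len e * (1 - G.foster M e ^ 2) := by
      rw [WeightedGraph.energy, Finset.mul_sum, Finset.mul_sum, ← Finset.sum_add_distrib,
        ← Finset.sum_sub_distrib]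
      exact Finset.sum_congr rfl fun e _ => hM.excess_eq y e
    rw [hM.energy_resistance] at h2
    have h3 := sum_K_mul_add_canon (G := G) M r
    have h4 : G.canon M r = G.canon M fun v => M v v := by
      have hr' : r = fun x => (M x x + M y y * 1) + (-2) * M x y := funext fun x => by
        rw [hr]; ring
      rw [hr', WeightedGraph.canon_add (fun x => M x x + M y y * 1) fun x => (-2) * M x y,
        WeightedGraph.canon_add (fun x => M x x) fun x => M y y * 1,
        WeightedGraph.canon_mul (M y y) (fun _ => 1), WeightedGraph.canon_mul, hM.canon_one,
        hM.canon_green]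
      ring
    have h5 : ∑ v, (G.K v : ℝ) * r v = ∑ v, (G.K v : ℝ) * M v v + (2 * G.genus - 2) * M y y -
        2 * G.canonicalPotential M y := by
      rw [← sum_K, canonicalPotential, Finset.sum_mul, Finset.mul_sum, ← Finset.sum_add_distrib,
        ← Finset.sum_sub_distrib]
      exact Finset.sum_congr rfl fun v _ => by rw [hr]; ring
    have h6 : ∑ p, (G.q p : ℝ) * (M p p - M p y - M y p + M y y) = ∑ p, (G.q p : ℝ) * r p :=
      Finset.sum_congr rfl fun p _ => by rw [hr, hM.symm y p]; ring
    rw [h6]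
    linarith
  simp only [h1]
  rw [slope_eq hG hb hM hg]
  have h2 : ∀ y, (G.K y : ℝ) * (3 / 4 * G.canon M (fun v => M v v) +
      1 / 2 * (∑ v, (G.K v : ℝ) * M v v + (2 * G.genus - 2) * M y y -
        2 * G.canonicalPotential M y) - 1 / 4 * ∑ e, G.len e * (1 - G.foster M e ^ 2)) =
      (G.K y : ℝ) * (3 / 4 * G.canon M (fun v => M v v) + 1 / 2 * ∑ v, (G.K v : ℝ) * M v v -
        1 / 4 * ∑ e, G.len e * (1 - G.foster M e ^ 2)) +
      (G.genus - 1) * ((G.K y : ℝ) * M y y) - (G.K y : ℝ) * G.canonicalPotential M y :=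
    fun y => by ring
  simp only [h2, Finset.sum_add_distrib, Finset.sum_sub_distrib, ← Finset.mul_sum,
    ← Finset.sum_mul, sum_K]
  ring

end PolarizedGraph

/-! ### Positivity of the excess -/

namespace WeightedGraph

variable {V E : Type*} {G : WeightedGraph V E}

/-- The edges to be removed in order to obtain `Γ - e - y`. -/
def cutSet (G : WeightedGraph V E) (y : V) (e : E) : Set E :=
  {e' | e' = e ∨ G.tail e' = y ∨ G.head e' = y}

theorem not_reachable_of_ne {y : V} {e : E} {u : V} (hu : u ≠ y) :
    ¬ (G.adjDelete (G.cutSet y e)).Reachable u y := by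
  intro h
  have := eq_of_reachable_adjDelete (f := fun v => v = y) (fun e' he' => by
    simp only [cutSet, Set.mem_ofPred_eq, not_or] at he'
    simp [he'.2.1, he'.2.2]) h
  exact hu (this.mpr rfl)

open Classical in
/-- For a function `h` vanishing at `z`, the current along the edge `e` into the vertex `z`. -/
noncomputable def flux (G : WeightedGraph V E) (h : V → ℝ) (z : V) (e : E) : ℝ :=
  ((if G.tail e = z then h (G.head e) else 0) + if G.head e = z then h (G.tail e) else 0) / G.len e

theorem flux_nonneg {h : V → ℝ} (hh : ∀ x, 0 ≤ h x) (z : V) (e : E) : 0 ≤ G.flux h z e := by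
  unfold flux
  refine div_nonneg (add_nonneg ?_ ?_) (G.len_pos e).le <;> split_ifs <;> simp [hh]

theorem flux_head_pos {h : V → ℝ} (hh : ∀ x, 0 ≤ h x) {e : E} (he : 0 < h (G.tail e)) :
    0 < G.flux h (G.head e) e := by
  unfold flux
  refine div_pos (add_pos_of_nonneg_of_pos ?_ ?_) (G.len_pos e)
  · split_ifs <;> simp [hh]
  · simpa using he

theorem flux_tail_pos {h : V → ℝ} (hh : ∀ x, 0 ≤ h x) {e : E} (he : 0 < h (G.head e)) :
    0 < G.flux h (G.tail e) e := by
  unfold flux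
  refine div_pos (add_pos_of_pos_of_nonneg ?_ ?_) (G.len_pos e)
  · simpa using he
  · split_ifs <;> simp [hh]

open Classical in
theorem energy_indicator [Fintype E] {h : V → ℝ} {z : V} (hz : h z = 0) :
    G.energy (fun x => if x = z then 1 else 0) h = -∑ e, G.flux h z e := by
  rw [energy, ← Finset.sum_neg_distrib]
  refine Finset.sum_congr rfl fun e _ => ?_
  unfold flux
  split_ifs with h1 h2 h2
  · rw [h1, h2, hz]; ring
  · rw [h1, hz]; ring
  · rw [h2, hz]; ring
  · ring

/-- The potential used to compare `tail e` and `head e`: it vanishes at `head e` and at the ground,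
and is harmonic away from these two vertices and `tail e`. -/
def edgePotential (G : WeightedGraph V E) (N : V → V → ℝ) (e : E) (x : V) : ℝ :=
  N (G.head e) (G.head e) * N x (G.tail e) - N (G.tail e) (G.head e) * N x (G.head e)

theorem excess_eq_sub (N : V → V → ℝ) (e : E) : G.excess N e =
    N (G.tail e) (G.head e) - G.edgePotential N e (G.tail e) / G.len e := by
  rw [excess, edgePotential]; ring

theorem excess_of_loop (N : V → V → ℝ) {e : E} (h : G.tail e = G.head e) :
    G.excess N e = N (G.tail e) (G.tail e) := by
  rw [excess, ← h]; ring

namespace IsGreenKernel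

variable [Fintype E] {y : V} {N : V → V → ℝ}

theorem energy_edgePotential (hN : G.IsGreenKernel y N) (e : E) (f : V → ℝ) :
    G.energy f (G.edgePotential N e) =
      N (G.head e) (G.head e) * (f (G.tail e) - f y) -
        N (G.tail e) (G.head e) * (f (G.head e) - f y) := by
  have := energy_sub_right f (G := G) (fun x => N (G.head e) (G.head e) * N x (G.tail e))
    fun x => N (G.tail e) (G.head e) * N x (G.head e)
  rwa [energy_smul_right, energy_smul_right, hN.energy_eq, hN.energy_eq] at this

theorem edgePotential_ground (hN : G.IsGreenKernel y N) (e : E) : G.edgePotential N e y = 0 := by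
  simp [edgePotential, hN.zero_left]

theorem edgePotential_head (hN : G.IsGreenKernel y N) (e : E) :
    G.edgePotential N e (G.head e) = 0 := by
  rw [edgePotential, hN.symm (G.head e) (G.tail e)]; ring

theorem edgePotential_tail_nonneg (hN : G.IsGreenKernel y N) (e : E) :
    0 ≤ G.edgePotential N e (G.tail e) := by
  have := hN.sq_le (G.tail e) (G.head e)
  rw [edgePotential]; linarith

theorem edgePotential_nonneg (hG : G.Connected) (hN : G.IsGreenKernel y N) (e : E) (x : V) :
    0 ≤ G.edgePotential N e x := by
  set h := G.edgePotential N e with hh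
  -- The negative part `m` of `h` has zero energy.
  set m : V → ℝ := fun x => min (h x) 0 with hm
  have hy : m y = 0 := by simp [hm, hh, hN.edgePotential_ground]
  have h0 : G.energy m h = 0 := by
    rw [hh, hN.energy_edgePotential, hy]
    have h1 : m (G.tail e) = 0 := min_eq_right (hN.edgePotential_tail_nonneg e)
    have h2 : m (G.head e) = 0 := by simp [hm, hh, hN.edgePotential_head]
    rw [h1, h2]; ring
  have h1 : G.energy m m ≤ G.energy m h := by
    refine Finset.sum_le_sum fun e' _ => div_le_div_of_nonneg_right ?_ (G.len_pos e').le
    simp only [hm]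
    rcases min_cases (h (G.tail e')) 0 with ⟨h1, h1'⟩ | ⟨h1, h1'⟩ <;>
      rcases min_cases (h (G.head e')) 0 with ⟨h2, h2'⟩ | ⟨h2, h2'⟩ <;> rw [h1, h2] <;> nlinarith
  have h2 := eq_of_energy_self_eq_zero hG (le_antisymm (h1.trans h0.le) (energy_self_nonneg m)) x y
  rw [hy] at h2
  exact min_eq_right_iff.1 h2

theorem edgePotential_tail_pos (hG : G.Connected) (hN : G.IsGreenKernel y N) {e : E}
    (hab : G.tail e ≠ G.head e) (ha : G.tail e ≠ y) (hb : G.head e ≠ y) :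
    0 < G.edgePotential N e (G.tail e) := by
  classical
  refine (hN.edgePotential_tail_nonneg e).lt_of_ne fun h0 => ?_
  have hE : G.energy (G.edgePotential N e) (G.edgePotential N e) = 0 := by
    rw [hN.energy_edgePotential, ← h0, hN.edgePotential_ground, hN.edgePotential_head]; ring
  have hc : G.edgePotential N e = fun _ => 0 := funext fun x => by
    rw [eq_of_energy_self_eq_zero hG hE x y, hN.edgePotential_ground]
  have h1 := hN.energy_edgePotential e fun x => if x = G.tail e then 1 else 0
  rw [hc, energy_const_right] at h1
  simp only [if_true, ha.symm, hab.symm, if_false] at h1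
  have := hN.diag_pos hG hb
  linarith

theorem sum_flux_edgePotential [DecidableEq V] (hN : G.IsGreenKernel y N) (e : E) {z : V}
    (hz : G.edgePotential N e z = 0) (hzy : z ≠ y) :
    ∑ e', G.flux (G.edgePotential N e) z e' =
      (if G.head e = z then N (G.tail e) (G.head e) else 0) -
        if G.tail e = z then N (G.head e) (G.head e) else 0 := by
  classical
  have h1 := hN.energy_edgePotential e fun x => if x = z then 1 else 0
  have h2 := energy_indicator (G := G) hz
  have h3 : (G.energy (fun x => if x = z then 1 else 0) (G.edgePotential N e)) =
      -∑ e', G.flux (G.edgePotential N e) z e' := by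
    convert h2
  rw [h3] at h1
  simp only [hzy.symm, if_false, sub_zero, mul_ite, mul_one, mul_zero] at h1
  linarith

/-- The excess is the current into `head e` along the edges other than `e`. -/
theorem excess_eq_sum_flux [DecidableEq E] (hN : G.IsGreenKernel y N) {e : E}
    (hab : G.tail e ≠ G.head e) (hb : G.head e ≠ y) :
    G.excess N e = ∑ e' ∈ Finset.univ.erase e, G.flux (G.edgePotential N e) (G.head e) e' := by
  classical
  have h1 := hN.sum_flux_edgePotential e (hN.edgePotential_head e) hb
  rw [if_pos rfl, if_neg hab, sub_zero,
    ← Finset.add_sum_erase _ _ (Finset.mem_univ e)] at h1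
  have h2 : G.flux (G.edgePotential N e) (G.head e) e =
      G.edgePotential N e (G.tail e) / G.len e := by
    simp [flux, hab]
  rw [excess_eq_sub, ← h1, h2]
  ring

theorem excess_of_endpoint (hN : G.IsGreenKernel y N) {e : E}
    (h : G.tail e = y ∨ G.head e = y) : G.excess N e = 0 := by
  rcases h with h | h <;> simp [excess, h, hN.zero_left, hN.zero_right]

theorem excess_nonneg (hG : G.Connected) (hN : G.IsGreenKernel y N) (e : E) :
    0 ≤ G.excess N e := by
  classical
  by_cases hb : G.head e = y
  · rw [hN.excess_of_endpoint (Or.inr hb)]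
  by_cases hab : G.tail e = G.head e
  · rw [excess_of_loop _ hab]; exact hN.diag_nonneg _
  rw [hN.excess_eq_sum_flux hab hb]
  exact Finset.sum_nonneg fun e' _ => flux_nonneg (hN.edgePotential_nonneg hG e) _ _

/-- The excess is positive when the endpoints of `e` are still connected in `Γ - e - y`. -/
theorem excess_pos (hG : G.Connected) (hN : G.IsGreenKernel y N) {e : E} (ha : G.tail e ≠ y)
    (hb : G.head e ≠ y)
    (hr : (G.adjDelete (G.cutSet y e)).Reachable (G.tail e) (G.head e)) :
    0 < G.excess N e := by
  classical
  by_cases hab : G.tail e = G.head e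
  · rw [excess_of_loop _ hab]; exact hN.diag_pos hG ha
  refine (hN.excess_nonneg hG e).lt_of_ne fun h0 => ?_
  have hpos := hN.edgePotential_tail_pos hG hab ha hb
  have hnonneg := hN.edgePotential_nonneg hG e
  -- No current enters a vertex of potential zero other than `y`, except along `e`.
  have hflux : ∀ z, z ≠ y → G.edgePotential N e z = 0 → ∀ e', e' ≠ e →
      G.flux (G.edgePotential N e) z e' = 0 := by
    intro z hzy hz e' he'
    by_cases hzb : z = G.head e
    · subst hzb
      rw [hN.excess_eq_sum_flux hab hb, eq_comm, Finset.sum_eq_zero_iff_of_nonneg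
        fun e' _ => flux_nonneg hnonneg _ _] at h0
      exact h0 e' (Finset.mem_erase.2 ⟨he', Finset.mem_univ _⟩)
    · have hza : G.tail e ≠ z := fun h => by rw [h, hz] at hpos; exact hpos.false
      have h1 := hN.sum_flux_edgePotential e hz hzy
      rw [if_neg (Ne.symm hzb), if_neg hza, sub_zero, Finset.sum_eq_zero_iff_of_nonneg
        fun e' _ => flux_nonneg hnonneg _ _] at h1
      exact h1 e' (Finset.mem_univ _)
  have hcl := eq_of_reachable_adjDelete (f := fun u => 0 < G.edgePotential N e u)
    (fun e' he' => by
      simp only [cutSet, Set.mem_ofPred_eq, not_or] at he'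
      refine propext ⟨fun h => ?_, fun h => ?_⟩
      · refine (hnonneg _).lt_of_ne fun h1 => ?_
        have := hflux _ he'.2.2 h1.symm e' he'.1
        exact (flux_head_pos hnonneg h).ne' this
      · refine (hnonneg _).lt_of_ne fun h1 => ?_
        have := hflux _ he'.2.1 h1.symm e' he'.1
        exact (flux_tail_pos hnonneg h).ne' this) hr
  have : 0 < G.edgePotential N e (G.head e) := hcl.mp hpos
  rw [hN.edgePotential_head] at this
  exact this.false

/-- The excess vanishes when `y` separates the endpoints of `e` in `Γ - e`. -/
theorem excess_eq_zero (hG : G.Connected) (hN : G.IsGreenKernel y N) {e : E}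
    (hb : G.head e ≠ y)
    (hr : ¬ (G.adjDelete (G.cutSet y e)).Reachable (G.tail e) (G.head e)) :
    G.excess N e = 0 := by
  classical
  have hab : G.tail e ≠ G.head e := fun h => hr (by rw [h])
  set C : V → Prop := fun u => (G.adjDelete (G.cutSet y e)).Reachable (G.head e) u with hC
  have hCa : ¬ C (G.tail e) := fun h => hr h.symm
  have hCb : C (G.head e) := SimpleGraph.Reachable.refl _
  have hCy : ¬ C y := not_reachable_of_ne hb
  have hCe : ∀ e', e' ∉ G.cutSet y e → (C (G.tail e') ↔ C (G.head e')) := fun e' he' =>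
    ⟨fun h => h.trans (G.reachable_tail_head he'),
      fun h => h.trans (G.reachable_tail_head he').symm⟩
  set h := G.edgePotential N e with hh
  have hy : h y = 0 := hN.edgePotential_ground e
  have hb0 : h (G.head e) = 0 := hN.edgePotential_head e
  -- The restriction `f` of the potential to the component of `head e` has zero energy.
  set f : V → ℝ := fun u => if C u then h u else 0 with hf
  have h0 : G.energy f h = 0 := by
    rw [hh, hN.energy_edgePotential]
    simp [hf, hCa, hCy, hb0]
  have h1 : G.energy f f = G.energy f h := by
    refine Finset.sum_congr rfl fun e' _ => congrArg (· / G.len e') ?_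
    simp only [hf]
    by_cases he' : e' ∈ G.cutSet y e
    · rcases he' with rfl | he' | he'
      · simp [hCa, hb0]
      · rw [he', if_neg hCy, hy]
        split_ifs <;> ring
      · rw [he', if_neg hCy, hy]
        split_ifs <;> ring
    · have := hCe e' he'
      by_cases ht : C (G.tail e')
      · rw [if_pos ht, if_pos (this.1 ht)]
      · rw [if_neg ht, if_neg fun h => ht (this.2 h)]; ring
  have h2 : ∀ u, C u → h u = 0 := fun u hu => by
    have := eq_of_energy_self_eq_zero hG (h1.trans h0) u y
    simpa [hf, hu, hCy] using this
  rw [hN.excess_eq_sum_flux hab hb]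
  refine Finset.sum_eq_zero fun e' he' => ?_
  have hne := (Finset.mem_erase.1 he').1
  have key : ∀ u v, (G.tail e' = u ∧ G.head e' = v ∨ G.tail e' = v ∧ G.head e' = u) →
      u = G.head e → h v = 0 := by
    rintro u v huv rfl
    by_cases hcut : e' ∈ G.cutSet y e
    · rcases hcut with h3 | h3 | h3
      · exact absurd h3 hne
      · rcases huv with huv | huv
        · exact absurd (huv.1.symm.trans h3) hb
        · rw [← huv.1, h3, hy]
      · rcases huv with huv | huv
        · rw [← huv.2, h3, hy]
        · exact absurd (huv.2.symm.trans h3) hb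
    · have := hCe e' hcut
      rcases huv with huv | huv
      · exact h2 _ (huv.2 ▸ this.1 (huv.1.symm ▸ hCb))
      · exact h2 _ (huv.1 ▸ this.2 (huv.2.symm ▸ hCb))
  unfold flux
  rw [div_eq_zero_iff]
  left
  split_ifs with h3 h4 h4
  · rw [← hh, key _ _ (Or.inl ⟨rfl, rfl⟩) h3, key _ _ (Or.inr ⟨rfl, rfl⟩) h4, add_zero]
  · rw [← hh, key _ _ (Or.inl ⟨rfl, rfl⟩) h3, add_zero]
  · rw [← hh, key _ _ (Or.inr ⟨rfl, rfl⟩) h4, add_zero]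
  · rw [add_zero]

end IsGreenKernel

/-! ### Counting edges -/

section Counting

variable [Fintype V] [Fintype E]

open Classical in
/-- If `Γ - y` is a forest, it has fewer edges than vertices. -/
theorem card_filter_add_two_le {y w : V} (hw : w ≠ y)
    (h : ∀ e, G.tail e ≠ y → G.head e ≠ y →
      ¬ (G.adjDelete (G.cutSet y e)).Reachable (G.tail e) (G.head e)) :
    (Finset.univ.filter fun e => G.tail e ≠ y ∧ G.head e ≠ y).card + 2 ≤ Fintype.card V := by
  -- The differences along the edges of `Γ - y` can be prescribed arbitrarily, because the indicator
  -- function of a component of `Γ - e - y` jumps only along `e`.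
  let T : (V → ℝ) →ₗ[ℝ] ({e // G.tail e ≠ y ∧ G.head e ≠ y} → ℝ) × ℝ × ℝ :=
    { toFun := fun f => (fun e => f (G.tail e) - f (G.head e), f y, f w)
      map_add' := fun f g => by
        ext <;> simp
        ring
      map_smul' := fun c f => by
        ext <;> simp [mul_sub] }
  let χ : E → V → ℝ := fun e u =>
    if (G.adjDelete (G.cutSet y e)).Reachable (G.tail e) u then 1 else 0
  have hχy : ∀ e, G.tail e ≠ y → χ e y = 0 := fun e he => if_neg (not_reachable_of_ne he)
  have hχe : ∀ e e', G.tail e' ≠ y → G.head e' ≠ y → G.tail e ≠ y → G.head e ≠ y →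
      χ e (G.tail e') - χ e (G.head e') = if e = e' then 1 else 0 := by
    intro e e' h1 h2 h3 h4
    split_ifs with hee
    · subst hee
      simp only [χ]
      rw [if_pos (SimpleGraph.Reachable.refl _), if_neg (h e h3 h4), sub_zero]
    · have he' : e' ∉ G.cutSet y e := by
        simp only [cutSet, Set.mem_ofPred_eq, not_or]
        exact ⟨Ne.symm hee, h1, h2⟩
      have := G.reachable_tail_head he'
      simp only [χ]
      rw [sub_eq_zero]
      congr 1
      exact propext ⟨fun h => h.trans this, fun h => h.trans this.symm⟩
  have hsurj : Function.Surjective T := by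
    rintro ⟨g, s, t⟩
    let f₀ : V → ℝ := fun u => ∑ e, g e * χ e u
    have hf₀ : f₀ y = 0 := Finset.sum_eq_zero fun e _ => by rw [hχy _ e.2.1, mul_zero]
    refine ⟨fun u => f₀ u + if u = y then s else t - f₀ w, ?_⟩
    refine Prod.ext (funext fun e => ?_) (Prod.ext ?_ ?_)
    · simp only [T, LinearMap.coe_mk, AddHom.coe_mk]
      rw [if_neg e.2.1, if_neg e.2.2, add_sub_add_right_eq_sub, ← Finset.sum_sub_distrib]
      simp only [← mul_sub]
      rw [Finset.sum_eq_single e]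
      · rw [hχe _ _ e.2.1 e.2.2 e.2.1 e.2.2, if_pos rfl, mul_one]
      · intro e' _ hne
        rw [hχe _ _ e.2.1 e.2.2 e'.2.1 e'.2.2, if_neg fun h => hne (Subtype.ext h), mul_zero]
      · simp
    · simp [T, hf₀]
    · simp [T, hw]
  have := LinearMap.finrank_le_finrank_of_surjective hsurj
  simp only [Module.finrank_prod, Module.finrank_fintype_fun_eq_card, Module.finrank_self,
    Fintype.card_subtype] at this
  omega

/-- If all vertices other than `y` have valency two, then no edge of `Γ - y` lies on a cycle of
`Γ - y`: the component containing it would be a cycle, not connected to `y`. -/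
theorem not_reachable_of_valency_eq_two (hG : G.Connected) {y : V}
    (hval : ∀ v, v ≠ y → G.valency v = 2) {e : E} (ha : G.tail e ≠ y) :
    ¬ (G.adjDelete (G.cutSet y e)).Reachable (G.tail e) (G.head e) := by
  classical
  intro hr
  set C : V → Prop := fun u => (G.adjDelete (G.cutSet y e)).Reachable (G.tail e) u with hC
  have hCa : C (G.tail e) := SimpleGraph.Reachable.refl _
  have hCy : ¬ C y := not_reachable_of_ne ha
  have hCe : ∀ e', e' ∉ G.cutSet y e → (C (G.tail e') ↔ C (G.head e')) := fun e' he' =>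
    ⟨fun h => h.trans (G.reachable_tail_head he'),
      fun h => h.trans (G.reachable_tail_head he').symm⟩
  -- The component `C` has at least `|C| - 1` edges.
  let T : (V → ℝ) →ₗ[ℝ] ({e' // e' ∉ G.cutSet y e ∧ C (G.tail e')} → ℝ) × ({u // ¬ C u} → ℝ) × ℝ :=
    { toFun := fun f => (fun e => f (G.tail e) - f (G.head e), fun u => f u, f (G.tail e))
      map_add' := fun f g => by
        ext <;> simp
        ring
      map_smul' := fun c f => by
        ext <;> simp [mul_sub] }
  have hinj : Function.Injective T := by
    rw [← LinearMap.ker_eq_bot, LinearMap.ker_eq_bot']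
    intro f hf
    have h1 : ∀ u, ¬ C u → f u = 0 := fun u hu =>
      congrFun (congrArg (fun p => p.2.1) hf) ⟨u, hu⟩
    have h2 : f (G.tail e) = 0 := congrArg (fun p => p.2.2) hf
    have h3 : ∀ e', e' ∉ G.cutSet y e → f (G.tail e') = f (G.head e') := fun e' he' => by
      by_cases ht : C (G.tail e')
      · exact sub_eq_zero.1 (congrFun (congrArg (fun p => p.1) hf) ⟨e', he', ht⟩)
      · rw [h1 _ ht, h1 _ fun h => ht ((hCe e' he').2 h)]
    funext u
    by_cases hu : C u
    · rw [← eq_of_reachable_adjDelete h3 hu, h2]; rfl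
    · exact h1 u hu
  have hrank := LinearMap.finrank_le_finrank_of_injective hinj
  simp only [Module.finrank_prod, Module.finrank_fintype_fun_eq_card, Module.finrank_self,
    Fintype.card_subtype] at hrank
  have hsplit := Finset.card_filter_add_card_filter_not (s := (Finset.univ : Finset V)) C
  rw [Finset.card_univ] at hsplit
  -- Counting half-edges at the vertices of `C`.
  set ind : V → ℝ := fun u => if C u then 1 else 0 with hind
  have hsum := G.sum_valency_mul ind
  have hleft : ∑ v, (G.valency v : ℝ) * ind v = 2 * (Finset.univ.filter C).card := by
    rw [Finset.card_filter]
    push_cast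
    rw [Finset.mul_sum]
    refine Finset.sum_congr rfl fun v _ => ?_
    simp only [hind]
    split_ifs with hv
    · rw [hval v fun h => hCy (h ▸ hv)]; norm_num
    · simp
  have hind0 : ∀ u, 0 ≤ ind u := fun u => by simp only [hind]; split_ifs <;> norm_num
  have hterm : ∀ e', 0 ≤ ind (G.tail e') + ind (G.head e') -
      2 * (if e' ∉ G.cutSet y e ∧ C (G.tail e') then 1 else 0) - 2 * if e' = e then 1 else 0 := by
    intro e'
    by_cases hee : e' = e
    · subst hee
      have : e' ∈ G.cutSet y e' := Or.inl rfl
      simp only [this, not_true, false_and, if_false, if_true, hind, hCa,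
        show C (G.head e') from hr]
      norm_num
    by_cases hcut : e' ∈ G.cutSet y e
    · simp only [hcut, hee, not_true, false_and, if_false]
      have := hind0 (G.tail e')
      have := hind0 (G.head e')
      linarith
    · have := hCe e' hcut
      by_cases ht : C (G.tail e')
      · simp only [hind, hcut, hee, ht, this.1 ht, not_false_eq_true, true_and, if_true, if_false]
        norm_num
      · simp only [hind, ht, mt this.2 ht, hee, and_false, if_false]
        norm_num
  have htotal : ∑ e', (ind (G.tail e') + ind (G.head e') -
      2 * (if e' ∉ G.cutSet y e ∧ C (G.tail e') then 1 else 0) - 2 * if e' = e then 1 else 0) =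
      2 * (Finset.univ.filter C).card -
      2 * (Finset.univ.filter fun e' => e' ∉ G.cutSet y e ∧ C (G.tail e')).card - 2 := by
    rw [Finset.sum_sub_distrib, Finset.sum_sub_distrib, ← hsum, hleft, ← Finset.mul_sum,
      ← Finset.mul_sum, Finset.sum_ite_eq' Finset.univ e, if_pos (Finset.mem_univ e), mul_one,
      Finset.sum_boole]
  have hle : (Finset.univ.filter C).card ≤
      (Finset.univ.filter fun e' => e' ∉ G.cutSet y e ∧ C (G.tail e')).card + 1 := by omega
  have hle' : ((Finset.univ.filter C).card : ℝ) ≤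
      (Finset.univ.filter fun e' => e' ∉ G.cutSet y e ∧ C (G.tail e')).card + 1 := by
    exact_mod_cast hle
  have hzero := (Finset.sum_eq_zero_iff_of_nonneg fun e' _ => hterm e').1
    (le_antisymm (by rw [htotal]; linarith) (Finset.sum_nonneg fun e' _ => hterm e'))
  -- Hence no edge leaves `C`, contradicting connectedness.
  have hclosed : ∀ e', e' ∉ (∅ : Set E) → C (G.tail e') = C (G.head e') := by
    intro e' _
    by_cases hee : e' = e
    · subst hee; exact propext ⟨fun _ => hr, fun _ => hCa⟩
    by_cases hcut : e' ∈ G.cutSet y e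
    · have h0 := hzero e' (Finset.mem_univ _)
      simp only [hcut, hee, not_true, false_and, if_false] at h0
      have h1 := hind0 (G.tail e')
      have h2 := hind0 (G.head e')
      have h3 : ind (G.tail e') = 0 := by linarith
      have h4 : ind (G.head e') = 0 := by linarith
      simp only [hind, ite_eq_right_iff, one_ne_zero, imp_false] at h3 h4
      exact propext ⟨fun h => absurd h h3, fun h => absurd h h4⟩
    · exact propext (hCe e' hcut)
  exact hCy ((eq_of_reachable_adjDelete hclosed (hG.preconnected (G.tail e) y)).mp hCa)

end Counting

end WeightedGraph

/-! ### Vanishing and positivity of the slope -/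

namespace PolarizedGraph

section

variable {V E : Type*} [Fintype E] {G : PolarizedGraph V E}

/-- A vertex outside the support of the canonical divisor is an ordinary point of the metric
graph. -/
theorem valency_eq_two_of_K_eq_zero (hG : G.Connected) {v y : V} (hvy : v ≠ y) (hv : G.K v = 0) :
    G.valency v = 2 ∧ G.q v = 0 := by
  classical
  have hpos : 0 < G.valency v := by
    by_contra! h0
    have h1 : (∀ e, G.tail e ≠ v) ∧ ∀ e, G.head e ≠ v := by
      simpa [WeightedGraph.valency, Finset.filter_eq_empty_iff] using h0
    have := WeightedGraph.eq_of_reachable_adjDelete (f := fun u => u = v) (S := ∅)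
      (fun e _ => by simp [h1.1 e, h1.2 e]) (hG.preconnected y v)
    exact hvy (this.mpr rfl).symm
  rw [K] at hv
  omega

open Classical in
theorem valency_add_card_filter_ge (y : V) : Fintype.card E ≤
    G.valency y + (Finset.univ.filter fun e => G.tail e ≠ y ∧ G.head e ≠ y).card := by
  rw [← Finset.card_univ, ← Finset.card_filter_add_card_filter_not
    (fun e => G.tail e ≠ y ∧ G.head e ≠ y), add_comm]
  gcongr
  rw [WeightedGraph.valency]
  refine le_trans (Finset.card_le_card fun e he => ?_) (Finset.card_union_le _ _)
  simp only [Finset.mem_filter, Finset.mem_univ, true_and, Finset.mem_union] at he ⊢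
  tauto

variable [Fintype V]

theorem slope_summand_nonneg (hG : G.Connected) {o : V} {M : V → V → ℝ} (hM : G.IsGreenKernel o M)
    (y : V) : 0 ≤ (G.K y : ℝ) * (∑ p, (G.q p : ℝ) * (M p p - M p y - M y p + M y y) +
      ∑ e, G.excess (fun x z => M x z - M x y - M y z + M y y) e) := by
  have hN := hM.reground y
  have hK : (0 : ℝ) ≤ G.K y := by exact_mod_cast G.K_nonneg y
  exact mul_nonneg hK (add_nonneg
    (Finset.sum_nonneg fun p _ => mul_nonneg (Nat.cast_nonneg _) (hN.diag_nonneg p))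
    (Finset.sum_nonneg fun e _ => hN.excess_nonneg hG e))

/-- Every vertex other than `y` has valency two and `q = 0`, so all local terms vanish. -/
theorem slope_eq_zero_of_support_eq_singleton (hG : G.Connected) (hb : G.Bridgeless)
    (hg : 0 < G.genus) {y : V} (hy : ∀ v, v ≠ y → G.K v = 0) : G.slope = 0 := by
  obtain ⟨M, hM⟩ := WeightedGraph.exists_isGreenKernel hG y
  have hN := hM.reground y
  have hval := fun v (hv : v ≠ y) => valency_eq_two_of_K_eq_zero hG hv (hy v hv)
  rw [slope_eq_sum hG hb hM hg]
  refine Finset.sum_eq_zero fun v _ => ?_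
  by_cases hv : v = y
  · subst hv
    have h1 : ∑ p, (G.q p : ℝ) * (M p p - M p v - M v p + M v v) = 0 :=
      Finset.sum_eq_zero fun p _ => by
        by_cases hp : p = v
        · rw [hp]; ring
        · rw [(hval p hp).2]; simp
    have h2 : ∑ e, G.excess (fun x z => M x z - M x v - M v z + M v v) e = 0 :=
      Finset.sum_eq_zero fun e _ => by
        by_cases ha : G.tail e = v
        · exact hN.excess_of_endpoint (Or.inl ha)
        by_cases hb : G.head e = v
        · exact hN.excess_of_endpoint (Or.inr hb)
        exact hN.excess_eq_zero hG hb
          (WeightedGraph.not_reachable_of_valency_eq_two hG (fun u hu => (hval u hu).1) ha)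
    rw [h1, h2]; ring
  · rw [hy v hv]; simp

/-- The local term `K(y) q(p) r(p, y)` is positive. -/
theorem slope_pos_of_q_ne_zero (hG : G.Connected) (hb : G.Bridgeless) (hg : 0 < G.genus) {p y : V}
    (hp : G.q p ≠ 0) (hy : G.K y ≠ 0) (hpy : p ≠ y) : 0 < G.slope := by
  obtain ⟨M, hM⟩ := WeightedGraph.exists_isGreenKernel hG y
  have hN := hM.reground y
  rw [slope_eq_sum hG hb hM hg]
  refine Finset.sum_pos' (fun v _ => slope_summand_nonneg hG hM v) ⟨y, Finset.mem_univ y, ?_⟩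
  have hK : (0 : ℝ) < G.K y := by exact_mod_cast lt_of_le_of_ne (G.K_nonneg y) (Ne.symm hy)
  have hq : (0 : ℝ) < G.q p := by exact_mod_cast Nat.pos_of_ne_zero hp
  refine mul_pos hK (add_pos_of_pos_of_nonneg ?_
    (Finset.sum_nonneg fun e _ => hN.excess_nonneg hG e))
  exact Finset.sum_pos' (fun p _ => mul_nonneg (Nat.cast_nonneg _) (hN.diag_nonneg p))
    ⟨p, Finset.mem_univ p, mul_pos hq (hN.diag_pos hG hpy)⟩

/-- If the slope were not positive, `Γ - y` would be a forest for each `y` in the support of `K`. -/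
theorem slope_pos_of_q_eq_zero (hG : G.Connected) (hb : G.Bridgeless) (hg : 2 ≤ G.genus)
    (hq : ∀ v, G.q v = 0) {S : Finset V} (hS : ∀ v, v ∈ S ↔ G.K v ≠ 0) (hcard : 3 ≤ S.card) :
    0 < G.slope := by
  classical
  by_contra! hle
  obtain ⟨o⟩ := hG.nonempty
  obtain ⟨M, hM⟩ := WeightedGraph.exists_isGreenKernel hG o
  rw [slope_eq_sum hG hb hM (by omega)] at hle
  have hzero := (Finset.sum_eq_zero_iff_of_nonneg fun y _ => slope_summand_nonneg hG hM y).1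
    (le_antisymm hle (Finset.sum_nonneg fun y _ => slope_summand_nonneg hG hM y))
  -- All the excesses vanish, so `Γ - y` is a forest for every `y` in the support of `K`; this
  -- bounds the valency of `y` below by `g + 1`.
  have hK : ∀ y ∈ S, G.genus - 1 ≤ G.K y := by
    intro y hy
    have hN := hM.reground y
    have hKy := (hS y).1 hy
    have h1 := (mul_eq_zero.1 (hzero y (Finset.mem_univ y))).resolve_left
      (by exact_mod_cast hKy)
    simp only [hq, Nat.cast_zero, zero_mul, Finset.sum_const_zero, zero_add] at h1
    have h2 := (Finset.sum_eq_zero_iff_of_nonneg fun e _ => hN.excess_nonneg hG e).1 h1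
    obtain ⟨w, -, hw⟩ := Finset.exists_mem_ne (by omega : 1 < S.card) y
    have h3 := WeightedGraph.card_filter_add_two_le (G := G.toWeightedGraph) hw
      fun e ha hb hr => (hN.excess_pos hG ha hb hr).ne' (h2 e (Finset.mem_univ e))
    have h4 := valency_add_card_filter_ge (G := G) y
    simp only [K, genus, hq, Nat.cast_zero, Finset.sum_const_zero]
    omega
  -- As `K` has degree `2 g - 2`, its support has at most two points.
  have hdeg : ∑ v, G.K v = 2 * G.genus - 2 := by exact_mod_cast G.sum_K
  have h1 : (S.card : ℤ) * (G.genus - 1) ≤ ∑ v, G.K v := by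
    rw [← nsmul_eq_mul]
    exact (Finset.card_nsmul_le_sum S G.K _ hK).trans
      (Finset.sum_le_univ_sum_of_nonneg fun v => G.K_nonneg v)
  have h2 : (3 : ℤ) ≤ S.card := by exact_mod_cast hcard
  nlinarith

end

/-- The vertices of the minimal model correspond to the support of the canonical divisor. -/
theorem IsMinimalModel.exists_equiv {V₀ E₀ V E : Type*} [Fintype V₀] [Fintype E₀] [Fintype V]
    [Fintype E] {G : PolarizedGraph V E} {H : PolarizedGraph V₀ E₀} (h : G.IsMinimalModel H) :
    ∃ f : V ≃ {v // H.K v ≠ 0}, ∀ v, H.q (f v) = G.q v := by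
  obtain ⟨Φ, -, hq, hsupp⟩ := h
  have h1 : ∀ v : V, ∃ u : {u // H.K u ≠ 0}, Φ (.vertex v) = .vertex u := fun v => by
    have : Φ (.vertex v) ∈ Function.support H.KPoint := hsupp ▸ ⟨_, ⟨v, rfl⟩, rfl⟩
    rcases hu : Φ (.vertex v) with u | ⟨e, t, ht⟩
    · rw [hu, Function.mem_support, KPoint] at this
      exact ⟨⟨u, by exact_mod_cast this⟩, rfl⟩
    · rw [hu] at this
      exact absurd rfl this
  choose f hf using h1
  refine ⟨Equiv.ofBijective f ⟨fun v w hvw => ?_, fun u => ?_⟩, fun v => ?_⟩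
  · have := (hf v).trans (hvw ▸ (hf w).symm)
    exact WeightedGraph.Point.vertex.inj (Φ.injective this)
  · have : (.vertex u.1 : H.Point) ∈ Function.support H.KPoint := u.2
    rw [← hsupp] at this
    obtain ⟨_, ⟨v, rfl⟩, hv⟩ := this
    exact ⟨v, Subtype.ext (WeightedGraph.Point.vertex.inj ((hf v).symm.trans hv))⟩
  · have := hq (.vertex v)
    rw [hf] at this
    exact this

end PolarizedGraph

theorem theorem3p1 {V₀ E₀ V E : Type*} [Fintype V₀] [Fintype E₀] [Fintype V] [Fintype E]
    (H : PolarizedGraph V₀ E₀) (hconn : H.Connected) (hbridgeless : H.Bridgeless)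
    (hgenus : 2 ≤ H.genus) (G : PolarizedGraph V E) (hmin : G.IsMinimalModel H) :
    (Fintype.card V = 1 → H.slope = 0) ∧
    (2 ≤ Fintype.card V → (∃ v, G.q v ≠ 0) → 0 < H.slope) ∧
    (G.TwoConnected → 3 ≤ Fintype.card V → 0 < H.slope) := by
  classical
  obtain ⟨f, hf⟩ := hmin.exists_equiv
  have hpos : 0 < H.genus := by omega
  have hb : 2 ≤ Fintype.card V → (∃ p, H.q p ≠ 0) → 0 < H.slope := by
    rintro hV ⟨p, hp⟩
    have : Nontrivial V := Fintype.one_lt_card_iff_nontrivial.1 hV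
    have : Nontrivial {v // H.K v ≠ 0} := f.symm.nontrivial
    obtain ⟨y, hy⟩ : ∃ y : {v // H.K v ≠ 0}, y.1 ≠ p := by
      obtain ⟨y, z, hyz⟩ := exists_pair_ne {v // H.K v ≠ 0}
      by_cases h : y.1 = p
      · exact ⟨z, fun h' => hyz (Subtype.ext (h.trans h'.symm))⟩
      · exact ⟨y, h⟩
    exact PolarizedGraph.slope_pos_of_q_ne_zero hconn hbridgeless hpos hp y.2 hy.symm
  refine ⟨fun hV => ?_, fun hV ⟨v, hv⟩ => hb hV ⟨f v, by rwa [hf]⟩, fun _ hV => ?_⟩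
  · obtain ⟨v, hv⟩ := Fintype.card_eq_one_iff.1 hV
    refine PolarizedGraph.slope_eq_zero_of_support_eq_singleton hconn hbridgeless hpos
      (y := (f v).1) fun u hu => ?_
    by_contra hK
    refine hu ?_
    rw [← hv (f.symm ⟨u, hK⟩), Equiv.apply_symm_apply]
  · by_cases hq : ∃ p, H.q p ≠ 0
    · exact hb (by omega) hq
    · push Not at hq
      refine PolarizedGraph.slope_pos_of_q_eq_zero hconn hbridgeless hgenus hq
        (S := Finset.univ.filter fun v => H.K v ≠ 0) (by simp) ?_
      rw [← Fintype.card_subtype, ← Fintype.card_congr f]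
      exact hV
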